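/- Let $\rho$ be a density matrix on $\mathbb{C}^d$, let $\Pi$ be an orthogonal projector on $\mathbb{C}^d$, let $\overline{\Pi} = I - \Pi$, and let $\sigma = \overline{\Pi}\rho\overline{\Pi}$. The *conditioned uniform POVM* applied to $\rho$ first performs the projective measurement $\{\Pi,\overline{\Pi}\}$. On outcome $\Pi$, which has probability $\mathrm{tr}(\Pi\rho)$, it outputs $\bot$. On outcome $\overline{\Pi}$, which has probability $\mathrm{tr}(\overline{\Pi}\rho) = \mathrm{tr}(\sigma)$, the state collapses to $\tau = \sigma/\mathrm{tr}(\sigma)$, the uniform POVM $\{d\,|u\rangle\langle u|\,du\}$ is performed on $\tau$ (where $du$ is the Haar probability measure on unit vectors of $\mathbb{C}^d$), and the observed unit vector $|u\rangle$, which has density $d\,\langle u|\tau|u\rangle$ with respect to $du$, is output. To an outcome one associates the matrix $\widehat{\sigma} = (d+1)|u\rangle\langle u| - I$ if the outcome is $|u\rangle$, and $\widehat{\sigma} = 0$ if it is $\bot$. Let $n$ and $k$ be positive integers with $k \le n/2$. Perform the conditioned uniform POVM separately on each of $n$ copies of $\rho$, so that the outcomes are independent, let $\widehat{\sigma}_1,\dots,\widehat{\sigma}_n$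 be the associated matrices, and define the conditioned $k$-th moment estimator $$Y_k = \frac{1}{n(n-1)\cdots(n-k+1)} \sum_{\text{distinct } i_1,\dots,i_k \in [n]} \mathrm{tr}\left(\widehat{\sigma}_{i_1}\widehat{\sigma}_{i_2}\cdots\widehat{\sigma}_{i_k}\right).$$ Then $Y_k$ is real-valued and square-integrable, it is an unbiased estimator of $\mathrm{tr}(\sigma^k)$, i.e. $\mathbf{E}[Y_k] = \mathrm{tr}(\sigma^k)$, and $$\mathrm{Var}[Y_k] \le \frac{24^k}{d} \sum_{j=0}^{k-1} \left(\frac{kd}{n}\right)^{k-j} \mathrm{tr}(\sigma^{2j}),$$ where $\sigma^0 = I$, so that $\mathrm{tr}(\sigma^0) = d$. -/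

import Mathlib

open MeasureTheory
open scoped ComplexOrder

noncomputable section

namespace CondMoment

/-- Density matrices (mixed states) on `ℂ^d`: positive semidefinite with trace one. -/
structure IsDensityMatrix {d : ℕ} (ρ : Matrix (Fin d) (Fin d) ℂ) : Prop where
  posSemidef : ρ.PosSemidef
  trace_eq_one : ρ.trace = 1

/-- Unit vectors of `ℂ^d` (with its Euclidean norm). -/
abbrev UnitVec (d : ℕ) : Type := Metric.sphere (0 : EuclideanSpace ℂ (Fin d)) 1

/-- The uniform ("Haar") probability measure on the unit vectors of `ℂ^d`: the surface measure
of the unit sphere, divided by its total mass. -/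
def haarUnit (d : ℕ) : Measure (UnitVec d) :=
  ((volume : Measure (EuclideanSpace ℂ (Fin d))).toSphere Set.univ)⁻¹ •
    (volume : Measure (EuclideanSpace ℂ (Fin d))).toSphere

/-- The rank-one projector `|u⟩⟨u|`, with entries `u_i * conj u_j`. -/
def ketbra {d : ℕ} (u : UnitVec d) : Matrix (Fin d) (Fin d) ℂ :=
  Matrix.of fun i j => u.1 i * star (u.1 j)

/-- The quadratic form `⟨u|M|u⟩`. -/
def braket {d : ℕ} (M : Matrix (Fin d) (Fin d) ℂ) (u : UnitVec d) : ℂ :=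
  ∑ i, ∑ j, star (u.1 i) * M i j * u.1 j

/-- Distribution of the outcome when the state `ρ` is measured with the uniform POVM
`{d |u⟩⟨u| du}`: density `d ⟨u|ρ|u⟩` with respect to the Haar measure. -/
def uniformPOVM {d : ℕ} (ρ : Matrix (Fin d) (Fin d) ℂ) : Measure (UnitVec d) :=
  (haarUnit d).withDensity fun u => ENNReal.ofReal (d * (braket ρ u).re)

/-- The subnormalized state `(1 - Q) ρ (1 - Q)`, where `1 - Q` is the complementary projector. -/
def subState {d : ℕ} (Q ρ : Matrix (Fin d) (Fin d) ℂ) : Matrix (Fin d) (Fin d) ℂ :=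
  (1 - Q) * ρ * (1 - Q)

/-- Outcomes of the conditioned uniform POVM: `Sum.inl ()` is the symbol `⊥`, and `Sum.inr u` is
the unit vector `u`. -/
abbrev Outcome (d : ℕ) : Type := Unit ⊕ UnitVec d

/-- Outcome distribution of the conditioned uniform POVM on `ρ`. The projective measurement
`{Q, 1 - Q}` is performed first. Outcome `Q` has probability `tr(Q ρ)` and yields `⊥`. Outcome
`1 - Q` has probability `tr((1 - Q) ρ)`; the state collapses to `σ / tr σ`, where
`σ = (1 - Q) ρ (1 - Q)`, and the uniform POVM is applied to it.
(If `tr σ = 0`, the second outcome has weight zero, so the collapsed state is irrelevant.) -/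
def conditionedPOVM {d : ℕ} (Q ρ : Matrix (Fin d) (Fin d) ℂ) : Measure (Outcome d) :=
  ENNReal.ofReal (Q * ρ).trace.re • Measure.dirac (Sum.inl ()) +
    ENNReal.ofReal ((1 - Q) * ρ).trace.re •
      (uniformPOVM ((subState Q ρ).trace⁻¹ • subState Q ρ)).map Sum.inr

/-- The single-copy estimator: `(d + 1) |u⟩⟨u| - 1` on outcome `u`, and `0` on outcome `⊥`. -/
def singleEstimator {d : ℕ} : Outcome d → Matrix (Fin d) (Fin d) ℂ
  | Sum.inl _ => 0
  | Sum.inr u => ((d : ℂ) + 1) • ketbra u - 1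

/-- The joint distribution of the outcomes when each of `n` copies of `ρ` is separately measured
with the conditioned uniform POVM. -/
def outcomeLaw {d : ℕ} (n : ℕ) (Q ρ : Matrix (Fin d) (Fin d) ℂ) : Measure (Fin n → Outcome d) :=
  Measure.pi fun _ => conditionedPOVM Q ρ

/-- The conditioned `k`-th moment estimator, as a function of the `n` outcomes: the average of
`tr(σ̂_{i₁} σ̂_{i₂} ⋯ σ̂_{i_k})` over all `n (n - 1) ⋯ (n - k + 1)` tuples of distinct indices. -/
def momentEstimator {d n : ℕ} (k : ℕ) (x : Fin n → Outcome d) : ℂ :=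
  (n.descFactorial k : ℂ)⁻¹ *
    ∑ i : Fin k ↪ Fin n, (List.ofFn fun a => singleEstimator (x (i a))).prod.trace

end CondMoment

end

/-! Write `X` for the single-copy estimator, `m` for the number of indices shared by two `k`-tuples,
and ‖·‖ for the Frobenius norm. The estimator is a U-statistic, so its second moment is an average
over pairs of tuples of E[tr(X_{i₁}⋯X_{i_k}) tr(X_{j₁}⋯X_{j_k})]. An index lying in only one of the
tuples occurs once in the product, and the product is linear in its letter, so independence lets
that letter be replaced by its mean σ. Disjoint pairs thus contribute exactly tr(σ^k)², and
unbiasedness holds for the same reason. For `m ≥ 1`, AM-GM reduces the matter to E|tr W|², where W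
is a word with `m` distinct random letters and `k - m` letters σ.

Two single-copy estimates control such words: E|tr(XB)|² ≤ 3‖B‖² and E‖σ^a X V‖² ≤ 3 tr(σ^{2a})‖V‖².
Cyclicity brings a random letter to the front, where the first estimate costs only a factor 3. The
second removes the other random letters one at a time. Each removal splits off a trace of a power of
σ, which Chebyshev's sum inequality on the eigenvalues, tr(σ^a) tr(σ^b) ≤ d tr(σ^{a+b}), merges back
at the price of a factor d. Hence E|tr W|² ≤ 3^m d^{m-1} tr(σ^{2(k-m)}). The proportion of tuples
sharing `m` indices with a given one is at most C(k,m)(k/n)^m, and summing over `m` gives the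
variance bound, even with 6^k in front.

The single-copy estimates follow from exact moments of a Haar unit vector up to the third:
E⟨A⟩⟨B⟩⟨C⟩ is 1/(d(d+1)(d+2)) times a sum over the six permutations of three letters. These moments
are derived from invariance of the sphere measure: phase changes of one coordinate kill the
unbalanced monomials, and rotations of two coordinates relate the remaining ones. The abstract
interface between the two halves is `IsEstimator`. -/

namespace CondMoment

/-! ### Trace inequalities for positive semidefinite matrices -/

section LinearAlgebra

variable {ι : Type*} [Fintype ι]

open Classical in
open scoped Matrix.Norms.L2Operator MatrixOrder in
theorem trace_mul_posSemidef_nonneg {A B : Matrix ι ι ℂ} (hA : A.PosSemidef)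
    (hB : B.PosSemidef) : 0 ≤ (A * B).trace := by
  obtain ⟨C, rfl⟩ := CStarAlgebra.nonneg_iff_eq_star_mul_self.mp hB.nonneg
  have h := (hA.mul_mul_conjTranspose_same C).trace_nonneg
  rwa [Matrix.trace_mul_cycle, Matrix.trace_mul_comm] at h

/-- The squared Frobenius norm. -/
noncomputable def frobSq (B : Matrix ι ι ℂ) : ℝ := (B.conjTranspose * B).trace.re

theorem trace_conjTranspose_mul_self (B : Matrix ι ι ℂ) :
    (B.conjTranspose * B).trace = (frobSq B : ℂ) := by
  have h := (Matrix.posSemidef_conjTranspose_mul_self B).trace_nonneg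
  exact (Complex.eq_re_of_ofReal_le (r := 0) (by simpa using h))

theorem frobSq_nonneg (B : Matrix ι ι ℂ) : 0 ≤ frobSq B :=
  (Complex.le_def.1 (Matrix.posSemidef_conjTranspose_mul_self B).trace_nonneg).1

variable [DecidableEq ι]

theorem trace_pow_eq_sum_eigenvalues {σ : Matrix ι ι ℂ} (hσ : σ.IsHermitian) (n : ℕ) :
    (σ ^ n).trace = ∑ i, ((hσ.eigenvalues i ^ n : ℝ) : ℂ) := by
  have h : σ ^ n = Unitary.conjStarAlgAut ℂ _ hσ.eigenvectorUnitary
      (Matrix.diagonal (fun i => (hσ.eigenvalues i : ℂ)) ^ n) := by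
    rw [map_pow]
    congr 1
    exact hσ.spectral_theorem
  rw [h, Unitary.conjStarAlgAut_apply, Matrix.trace_mul_cycle, Unitary.coe_star_mul_self, one_mul,
    Matrix.diagonal_pow, Matrix.trace_diagonal]
  simp

theorem re_trace_pow_nonneg {σ : Matrix ι ι ℂ} (hσ : σ.PosSemidef) (n : ℕ) :
    0 ≤ (σ ^ n).trace.re :=
  (Complex.le_def.1 (hσ.pow n).trace_nonneg).1

theorem trace_pow_eq_re {σ : Matrix ι ι ℂ} (hσ : σ.PosSemidef) (n : ℕ) :
    (σ ^ n).trace = ((σ ^ n).trace.re : ℂ) :=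
  Complex.eq_re_of_ofReal_le (r := 0) (by simpa using (hσ.pow n).trace_nonneg)

/-- Chebyshev's sum inequality: the eigenvalues are nonnegative, so their `a`-th and `b`-th powers
are ordered the same way. -/
theorem re_trace_pow_mul_re_trace_pow_le {σ : Matrix ι ι ℂ} (hσ : σ.PosSemidef) (a b : ℕ) :
    (σ ^ a).trace.re * (σ ^ b).trace.re ≤ Fintype.card ι * (σ ^ (a + b)).trace.re := by
  simp only [trace_pow_eq_sum_eigenvalues hσ.1, Complex.re_sum, Complex.ofReal_re]
  simp only [pow_add]
  refine Monovary.sum_mul_sum_le_card_mul_sum (f := fun i => hσ.1.eigenvalues i ^ a)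
    (g := fun i => hσ.1.eigenvalues i ^ b) ?_
  intro i j (hij : hσ.1.eigenvalues i ^ b < hσ.1.eigenvalues j ^ b)
  refine pow_le_pow_left₀ (hσ.eigenvalues_nonneg i) (le_of_not_gt fun h => ?_) a
  exact absurd hij (not_lt.2 (pow_le_pow_left₀ (hσ.eigenvalues_nonneg j) h.le b))

theorem re_trace_mul_le {σ A : Matrix ι ι ℂ} (hσ : (1 - σ).PosSemidef) (hA : A.PosSemidef) :
    (σ * A).trace.re ≤ A.trace.re := by
  have h := (Complex.le_def.1 (trace_mul_posSemidef_nonneg hσ hA)).1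
  simp only [sub_mul, one_mul, Matrix.trace_sub, Complex.sub_re, Complex.zero_re] at h
  linarith

/-- Each eigenvalue is at most the sum of all of them, which is the trace; `1 - σ` is diagonal in
the same eigenbasis. -/
theorem one_sub_posSemidef_of_trace_le_one {σ : Matrix ι ι ℂ} (hσ : σ.PosSemidef)
    (h : σ.trace.re ≤ 1) : (1 - σ).PosSemidef := by
  have hle : ∀ i, hσ.1.eigenvalues i ≤ 1 := fun i => by
    refine le_trans ?_ h
    rw [hσ.1.trace_eq_sum_eigenvalues, Complex.re_sum]
    exact Finset.single_le_sum (f := fun i => hσ.1.eigenvalues i)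
      (fun j _ => hσ.eigenvalues_nonneg j) (Finset.mem_univ i)
  have hdiag : (Matrix.diagonal fun i => ((1 - hσ.1.eigenvalues i : ℝ) : ℂ)).PosSemidef := by
    refine Matrix.PosSemidef.diagonal fun i => ?_
    exact Complex.zero_le_real.2 (sub_nonneg.2 (hle i))
  have hU : 1 - σ = Unitary.conjStarAlgAut ℂ _ hσ.1.eigenvectorUnitary
      (Matrix.diagonal fun i => ((1 - hσ.1.eigenvalues i : ℝ) : ℂ)) := by
    have h2 : (Matrix.diagonal fun i => ((1 - hσ.1.eigenvalues i : ℝ) : ℂ)) =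
        1 - Matrix.diagonal (fun i => (hσ.1.eigenvalues i : ℂ)) := by
      rw [← Matrix.diagonal_one, Matrix.diagonal_sub]
      simp
    rw [h2, map_sub, map_one]
    congr 1
    exact hσ.1.spectral_theorem
  rw [hU, Unitary.conjStarAlgAut_apply]
  exact hdiag.mul_mul_conjTranspose_same _

end LinearAlgebra

/-! ### Bounded measurable functions, which make every integrability claim automatic -/

section BoundedMeasurable

variable {α β E : Type*} [MeasurableSpace α] [MeasurableSpace β]
  [NormedRing E] [MeasurableSpace E] [BorelSpace E] [SecondCountableTopology E]

/-- Bounded measurable functions. -/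
def BddMeas (f : α → E) : Prop := Measurable f ∧ ∃ C : ℝ, ∀ x, ‖f x‖ ≤ C

omit [BorelSpace E] [SecondCountableTopology E] in
theorem BddMeas.const (c : E) : BddMeas fun _ : α => c := ⟨measurable_const, ‖c‖, fun _ => le_rfl⟩

omit [BorelSpace E] [SecondCountableTopology E] in
theorem BddMeas.comp {f : α → E} (hf : BddMeas f) {g : β → α} (hg : Measurable g) :
    BddMeas fun x => f (g x) :=
  ⟨hf.1.comp hg, hf.2.imp fun _ h x => h (g x)⟩

theorem BddMeas.add {f g : α → E} (hf : BddMeas f) (hg : BddMeas g) :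
    BddMeas fun x => f x + g x := by
  obtain ⟨C, hC⟩ := hf.2
  obtain ⟨D, hD⟩ := hg.2
  exact ⟨hf.1.add hg.1, C + D, fun x => (norm_add_le _ _).trans (add_le_add (hC x) (hD x))⟩

theorem BddMeas.mul {f g : α → E} (hf : BddMeas f) (hg : BddMeas g) :
    BddMeas fun x => f x * g x := by
  obtain ⟨C, hC⟩ := hf.2
  obtain ⟨D, hD⟩ := hg.2
  exact ⟨hf.1.mul hg.1, C * D, fun x => (norm_mul_le _ _).trans
    (mul_le_mul (hC x) (hD x) (norm_nonneg _) ((norm_nonneg _).trans (hC x)))⟩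

theorem BddMeas.sum {κ : Type*} {s : Finset κ} {f : κ → α → E} (hf : ∀ i ∈ s, BddMeas (f i)) :
    BddMeas fun x => ∑ i ∈ s, f i x := by
  classical
  induction s using Finset.induction_on with
  | empty => simpa using BddMeas.const 0
  | insert i s his ih =>
    simp only [Finset.sum_insert his]
    exact (hf i (Finset.mem_insert_self i s)).add
      (ih fun j hj => hf j (Finset.mem_insert_of_mem hj))

theorem BddMeas.integrable {f : α → E} (hf : BddMeas f) (μ : Measure α) [IsFiniteMeasure μ] :
    Integrable f μ := by
  obtain ⟨C, hC⟩ := hf.2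
  exact Integrable.of_bound hf.1.aestronglyMeasurable C (Filter.Eventually.of_forall hC)

theorem BddMeas.memLp {f : α → E} (hf : BddMeas f) (μ : Measure α) [IsFiniteMeasure μ]
    (p : ENNReal) : MemLp f p μ := by
  obtain ⟨C, hC⟩ := hf.2
  exact MemLp.of_bound hf.1.aestronglyMeasurable C (Filter.Eventually.of_forall hC)

theorem BddMeas.re {f : α → ℂ} (hf : BddMeas f) : BddMeas fun x => (f x).re :=
  ⟨Complex.measurable_re.comp hf.1, hf.2.imp fun _ h x => (Complex.abs_re_le_norm _).trans (h x)⟩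

theorem BddMeas.star {f : α → ℂ} (hf : BddMeas f) : BddMeas fun x => star (f x) :=
  ⟨(continuous_star.measurable).comp hf.1, hf.2.imp fun _ h x => by simpa using h x⟩

theorem BddMeas.norm_sq {f : α → ℂ} (hf : BddMeas f) : BddMeas fun x => ‖f x‖ ^ 2 := by
  have h : BddMeas fun x => ‖f x‖ := ⟨hf.1.norm, hf.2.imp fun _ h x => by simpa using h x⟩
  simpa only [sq] using h.mul h

end BoundedMeasurable

/-! ### Bounded measurable random matrices -/

section MatrixBdd

variable {α β ι : Type*} [MeasurableSpace α] [MeasurableSpace β]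

/-- Matrix-valued functions whose entries are bounded and measurable. -/
def MatBddMeas (f : α → Matrix ι ι ℂ) : Prop := ∀ p q, BddMeas fun x => f x p q

theorem MatBddMeas.const (A : Matrix ι ι ℂ) : MatBddMeas fun _ : α => A :=
  fun _ _ => BddMeas.const _

theorem MatBddMeas.comp {f : α → Matrix ι ι ℂ} (hf : MatBddMeas f) {g : β → α}
    (hg : Measurable g) : MatBddMeas fun x => f (g x) :=
  fun p q => (hf p q).comp hg

variable [Fintype ι]

theorem MatBddMeas.mul {f g : α → Matrix ι ι ℂ} (hf : MatBddMeas f) (hg : MatBddMeas g) :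
    MatBddMeas fun x => f x * g x := fun p q => by
  simp only [Matrix.mul_apply]
  exact BddMeas.sum fun i _ => (hf p i).mul (hg i q)

omit [Fintype ι] in
theorem MatBddMeas.conjTranspose {f : α → Matrix ι ι ℂ} (hf : MatBddMeas f) :
    MatBddMeas fun x => (f x).conjTranspose := fun p q => (hf q p).star

theorem MatBddMeas.trace {f : α → Matrix ι ι ℂ} (hf : MatBddMeas f) :
    BddMeas fun x => (f x).trace := BddMeas.sum fun i _ => hf i i

theorem MatBddMeas.frobSq {f : α → Matrix ι ι ℂ} (hf : MatBddMeas f) :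
    BddMeas fun x => frobSq (f x) := (hf.conjTranspose.mul hf).trace.re

theorem MatBddMeas.list_prod [DecidableEq ι] {κ : Type*} (l : List κ)
    {f : κ → α → Matrix ι ι ℂ} (hf : ∀ i ∈ l, MatBddMeas (f i)) :
    MatBddMeas fun x => (l.map fun i => f i x).prod := by
  induction l with
  | nil => simpa using MatBddMeas.const 1
  | cons i l ih =>
    simp only [List.map_cons, List.prod_cons]
    exact (hf i (by simp)).mul (ih fun j hj => hf j (by simp [hj]))

end MatrixBdd

/-! ### Resampling one coordinate of a product measure -/

section Update

variable {κ Ω : Type*} [Fintype κ] [DecidableEq κ] [MeasurableSpace Ω]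

/-- It is enough to compare boxes: the preimage of a box is the same box with its `i`-th side freed,
times that side for the fresh sample. -/
theorem measurePreserving_update (μ : Measure Ω) [IsProbabilityMeasure μ] (i : κ) :
    MeasurePreserving (fun z : (κ → Ω) × Ω => Function.update z.1 i z.2)
      ((Measure.pi fun _ => μ).prod μ) (Measure.pi fun _ => μ) := by
  have hm : Measurable fun z : (κ → Ω) × Ω => Function.update z.1 i z.2 := by
    refine measurable_pi_iff.2 fun j => ?_
    by_cases h : j = i
    · subst h
      simpa using measurable_snd
    · simpa [Function.update_of_ne h] using
        (show Measurable fun z : (κ → Ω) × Ω => z.1 j from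
          (measurable_pi_apply j).comp measurable_fst)
  refine ⟨hm, (Measure.pi_eq fun s hs => ?_).symm⟩
  rw [Measure.map_apply hm (MeasurableSet.univ_pi hs)]
  have hpre : (fun z : (κ → Ω) × Ω => Function.update z.1 i z.2) ⁻¹' Set.univ.pi s =
      (Set.univ.pi (Function.update s i Set.univ)) ×ˢ s i := by
    ext ⟨x, ω⟩
    simp only [Set.mem_preimage, Set.mem_pi, Set.mem_univ, true_imp_iff, Set.mem_prod]
    constructor
    · intro h
      refine ⟨fun j => ?_, by simpa using h i⟩
      by_cases hj : j = i
      · subst hj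
        simp
      · simpa [Function.update_of_ne hj] using h j
    · rintro ⟨h, hi⟩ j
      by_cases hj : j = i
      · subst hj
        simpa using hi
      · simpa [Function.update_of_ne hj] using h j
  rw [hpre, Measure.prod_prod, Measure.pi_pi, ← Finset.mul_prod_erase _ _ (Finset.mem_univ i),
    ← Finset.mul_prod_erase _ (fun j => μ (s j)) (Finset.mem_univ i)]
  simp only [Function.update_self, measure_univ, one_mul]
  rw [mul_comm]
  congr 1
  refine Finset.prod_congr rfl fun j hj => ?_
  rw [Function.update_of_ne (Finset.ne_of_mem_erase hj)]

/-- Fubini in a form that keeps the index type fixed: averaging over coordinate `i` alone becomes an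
inner integral over a fresh value. -/
theorem integral_pi_eq_integral_update {E : Type*} [NormedRing E] [NormedSpace ℝ E]
    [MeasurableSpace E] [BorelSpace E] [SecondCountableTopology E]
    (μ : Measure Ω) [IsProbabilityMeasure μ] (i : κ) {f : (κ → Ω) → E} (hf : BddMeas f) :
    ∫ x, f x ∂(Measure.pi fun _ => μ) =
      ∫ x, ∫ ω, f (Function.update x i ω) ∂μ ∂(Measure.pi fun _ => μ) := by
  have hmp := measurePreserving_update μ i
  have h1 := integral_map (μ := (Measure.pi fun _ => μ).prod μ) hmp.1.aemeasurable
    (f := f) (by rw [hmp.2]; exact hf.1.aestronglyMeasurable)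
  rw [hmp.2] at h1
  rw [h1, integral_prod _ ((hf.comp hmp.1).integrable _)]

end Update

/-! ### Random words in independent letters and the constant letter σ -/

section Words

variable {ι κ Ω : Type*} [Fintype ι] [DecidableEq ι] [MeasurableSpace Ω]

/-- A bounded Hermitian random matrix with mean `σ` whose second moments satisfy the bounds that
hold for the single-copy estimator of a conditioned uniform measurement. -/
structure IsEstimator (μ : Measure Ω) (X : Ω → Matrix ι ι ℂ) (σ : Matrix ι ι ℂ) : Prop where
  bddMeas : MatBddMeas X
  isHermitian : ∀ ω, (X ω).IsHermitian
  mean : ∀ p q, ∫ ω, X ω p q ∂μ = σ p q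
  trace_sq_le : ∀ B : Matrix ι ι ℂ, ∫ ω, ‖(X ω * B).trace‖ ^ 2 ∂μ ≤ 3 * frobSq B
  frobSq_le : ∀ (a : ℕ) (V : Matrix ι ι ℂ),
    ∫ ω, frobSq (σ ^ a * (X ω * V)) ∂μ ≤ 3 * (σ ^ (2 * a)).trace.re * frobSq V

/-- The product of a word in the constant letter `σ` (written `none`) and the random letters
`X (x i)` (written `some i`). -/
def wordVal (X : Ω → Matrix ι ι ℂ) (σ : Matrix ι ι ℂ) (x : κ → Ω) (w : List (Option κ)) :
    Matrix ι ι ℂ :=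
  (w.map fun o => o.elim σ fun i => X (x i)).prod

variable {X : Ω → Matrix ι ι ℂ} {σ : Matrix ι ι ℂ}

omit [MeasurableSpace Ω] in
theorem wordVal_nil (x : κ → Ω) : wordVal X σ x [] = 1 := rfl

omit [MeasurableSpace Ω] in
theorem wordVal_cons_none (x : κ → Ω) (w : List (Option κ)) :
    wordVal X σ x (none :: w) = σ * wordVal X σ x w := by simp [wordVal]

omit [MeasurableSpace Ω] in
theorem wordVal_cons_some (x : κ → Ω) (i : κ) (w : List (Option κ)) :
    wordVal X σ x (some i :: w) = X (x i) * wordVal X σ x w := by simp [wordVal]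

omit [MeasurableSpace Ω] in
theorem wordVal_append (x : κ → Ω) (v w : List (Option κ)) :
    wordVal X σ x (v ++ w) = wordVal X σ x v * wordVal X σ x w := by simp [wordVal]

omit [MeasurableSpace Ω] in
theorem wordVal_update [DecidableEq κ] (x : κ → Ω) {i : κ} (ω : Ω) {w : List (Option κ)}
    (hi : i ∉ w.reduceOption) :
    wordVal X σ (Function.update x i ω) w = wordVal X σ x w := by
  unfold wordVal
  congr 1
  refine List.map_congr_left fun o ho => ?_
  cases o with
  | none => rfl
  | some j =>
    have hj : j ≠ i := fun h => hi (List.reduceOption_mem_iff.2 (h ▸ ho))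
    simp [Function.update_of_ne hj]

theorem bddMeas_wordVal (hX : MatBddMeas X) (w : List (Option κ)) :
    MatBddMeas fun x : κ → Ω => wordVal X σ x w := by
  refine MatBddMeas.list_prod (f := fun (o : Option κ) (x : κ → Ω) =>
    o.elim σ fun i => X (x i)) w fun o _ => ?_
  cases o with
  | none => exact MatBddMeas.const σ
  | some i => exact hX.comp (measurable_pi_apply i)

variable [Fintype κ] [DecidableEq κ] {μ : Measure Ω} [IsProbabilityMeasure μ]

/-- Induction on the word, with `a` accumulating the constant letters met so far. A leading random
letter does not recur, so it can be averaged with the rest frozen; this resets `a` to zero and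
leaves two traces to be merged. -/
theorem IsEstimator.integral_frobSq_le (h : IsEstimator μ X σ) (hσ : σ.PosSemidef)
    (w : List (Option κ)) (hw : w.reduceOption.Nodup) (a : ℕ) :
    ∫ x, frobSq (σ ^ a * wordVal X σ x w) ∂(Measure.pi fun _ => μ) ≤
      (3 * Fintype.card ι) ^ w.reduceOption.length * (σ ^ (2 * (a + w.count none))).trace.re := by
  induction w generalizing a with
  | nil =>
    simp only [wordVal_nil, mul_one, integral_const, probReal_univ, one_smul]
    simp [frobSq, (hσ.1.pow a).eq, ← pow_add, two_mul]
  | cons o w ih =>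
    cases o with
    | none =>
      have h1 := ih (by simpa using hw) (a + 1)
      simp only [wordVal_cons_none, ← mul_assoc, ← pow_succ]
      refine h1.trans (le_of_eq ?_)
      rw [List.reduceOption_cons_of_none, List.count_cons_self]
      congr 5
      ring
    | some i =>
      rw [List.reduceOption_cons_of_some, List.nodup_cons] at hw
      have hmeas : BddMeas fun x : κ → Ω => frobSq (σ ^ a * wordVal X σ x (some i :: w)) :=
        ((MatBddMeas.const _).mul (bddMeas_wordVal h.bddMeas _)).frobSq
      rw [integral_pi_eq_integral_update μ i hmeas]
      simp only [wordVal_cons_some, wordVal_update _ _ hw.1, Function.update_self]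
      have h0 := ih hw.2 0
      simp only [pow_zero, one_mul, zero_add] at h0
      have hV : BddMeas fun x : κ → Ω => frobSq (wordVal X σ x w) :=
        (bddMeas_wordVal h.bddMeas _).frobSq
      have hT := re_trace_pow_nonneg hσ (2 * a)
      have hT' := re_trace_pow_nonneg hσ (2 * w.count none)
      calc ∫ x, ∫ ω, frobSq (σ ^ a * (X ω * wordVal X σ x w)) ∂μ ∂(Measure.pi fun _ => μ)
          ≤ ∫ x, 3 * (σ ^ (2 * a)).trace.re * frobSq (wordVal X σ x w)
              ∂(Measure.pi fun _ => μ) :=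
            integral_mono_of_nonneg
              (Filter.Eventually.of_forall fun x => integral_nonneg fun ω => frobSq_nonneg _)
              ((hV.integrable _).const_mul _) (Filter.Eventually.of_forall fun x => h.frobSq_le a _)
        _ = 3 * (σ ^ (2 * a)).trace.re *
              ∫ x, frobSq (wordVal X σ x w) ∂(Measure.pi fun _ => μ) := integral_const_mul _ _
        _ ≤ 3 * (σ ^ (2 * a)).trace.re * ((3 * Fintype.card ι) ^ w.reduceOption.length *
              (σ ^ (2 * w.count none)).trace.re) := by gcongr
        _ = 3 * (3 * Fintype.card ι) ^ w.reduceOption.length *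
              ((σ ^ (2 * a)).trace.re * (σ ^ (2 * w.count none)).trace.re) := by ring
        _ ≤ 3 * (3 * Fintype.card ι) ^ w.reduceOption.length *
              (Fintype.card ι * (σ ^ (2 * a + 2 * w.count none)).trace.re) := by
            -- Merging the traces on the two sides of the removed letter is what costs the factor
            -- `d`.
            exact mul_le_mul_of_nonneg_left (re_trace_pow_mul_re_trace_pow_le hσ _ _)
              (by positivity)
        _ = _ := by
            rw [List.reduceOption_cons_of_some, List.length_cons, pow_succ,
              List.count_cons_of_ne (by simp), mul_add]
            ring

/-- The trace is cyclic, so some random letter may be put first. Averaging it with `trace_sq_le`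
leaves no trace to merge, hence one power of `d` fewer than in the Frobenius bound. -/
theorem IsEstimator.integral_norm_trace_sq_le (h : IsEstimator μ X σ) (hσ : σ.PosSemidef)
    (w : List (Option κ)) (hw : w.reduceOption.Nodup) (hm : w.reduceOption ≠ []) :
    ∫ x, ‖(wordVal X σ x w).trace‖ ^ 2 ∂(Measure.pi fun _ => μ) ≤
      3 ^ w.reduceOption.length * (Fintype.card ι : ℝ) ^ (w.reduceOption.length - 1) *
        (σ ^ (2 * w.count none)).trace.re := by
  obtain ⟨i, hi⟩ := List.exists_mem_of_ne_nil _ hm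
  obtain ⟨u, v, rfl⟩ := List.append_of_mem (List.reduceOption_mem_iff.1 hi)
  have hperm : (u ++ some i :: v).Perm (some i :: (v ++ u)) :=
    List.perm_middle.trans ((List.perm_append_comm).cons _)
  have hred : (u ++ some i :: v).reduceOption.Perm (i :: (v ++ u).reduceOption) := by
    have := hperm.filterMap id
    simpa [List.reduceOption] using this
  have hnd := hred.nodup_iff.1 hw
  rw [List.nodup_cons] at hnd
  have hcyc : ∀ x : κ → Ω, (wordVal X σ x (u ++ some i :: v)).trace =
      (X (x i) * wordVal X σ x (v ++ u)).trace := fun x => by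
    rw [wordVal_append, wordVal_cons_some, wordVal_append, Matrix.trace_mul_comm, mul_assoc]
  rw [hred.length_eq, hperm.count_eq, List.count_cons_of_ne (by simp)]
  simp only [hcyc]
  have hmeas : BddMeas fun x : κ → Ω => ‖(X (x i) * wordVal X σ x (v ++ u)).trace‖ ^ 2 :=
    ((h.bddMeas.comp (measurable_pi_apply i)).mul
      (bddMeas_wordVal h.bddMeas _)).trace.norm_sq
  have hV : BddMeas fun x : κ → Ω => frobSq (wordVal X σ x (v ++ u)) :=
    (bddMeas_wordVal h.bddMeas _).frobSq
  rw [integral_pi_eq_integral_update μ i hmeas]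
  simp only [wordVal_update _ _ hnd.1, Function.update_self]
  have h0 := h.integral_frobSq_le hσ (v ++ u) hnd.2 0
  simp only [pow_zero, one_mul, zero_add] at h0
  calc ∫ x, ∫ ω, ‖(X ω * wordVal X σ x (v ++ u)).trace‖ ^ 2 ∂μ ∂(Measure.pi fun _ => μ)
      ≤ ∫ x, 3 * frobSq (wordVal X σ x (v ++ u)) ∂(Measure.pi fun _ => μ) :=
        integral_mono_of_nonneg
          (Filter.Eventually.of_forall fun x => integral_nonneg fun ω => by positivity)
          ((hV.integrable _).const_mul _) (Filter.Eventually.of_forall fun x => h.trace_sq_le _)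
    _ = 3 * ∫ x, frobSq (wordVal X σ x (v ++ u)) ∂(Measure.pi fun _ => μ) :=
        integral_const_mul _ _
    _ ≤ 3 * ((3 * Fintype.card ι) ^ (v ++ u).reduceOption.length *
          (σ ^ (2 * (v ++ u).count none)).trace.re) := by gcongr
    _ = _ := by
        rw [List.length_cons, Nat.add_sub_cancel, pow_succ, mul_pow]
        ring

/-- Replace the random letters with index in `T` by the constant letter. -/
def eraseLetters (T : Finset κ) (o : Option κ) : Option κ := o.filter fun i => i ∉ T

theorem IsEstimator.integral_linear (h : IsEstimator μ X σ) (L : Matrix ι ι ℂ →ₗ[ℂ] ℂ) :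
    ∫ ω, L (X ω) ∂μ = L σ := by
  have hL : ∀ A : Matrix ι ι ℂ, L A = ∑ p, ∑ q, A p q * L (Matrix.single p q 1) := fun A => by
    conv_lhs => rw [Matrix.matrix_eq_sum_single A]
    simp only [map_sum]
    refine Finset.sum_congr rfl fun p _ => Finset.sum_congr rfl fun q _ => ?_
    rw [← smul_eq_mul, ← map_smul, Matrix.smul_single, smul_eq_mul, mul_one]
  simp only [hL (X _)]
  rw [integral_finsetSum _ fun p _ => (BddMeas.sum fun q _ =>
    (h.bddMeas p q).mul (BddMeas.const _)).integrable μ, hL σ]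
  refine Finset.sum_congr rfl fun p _ => ?_
  rw [integral_finsetSum _ fun q _ => ((h.bddMeas p q).mul (BddMeas.const _)).integrable μ]
  refine Finset.sum_congr rfl fun q _ => ?_
  rw [integral_mul_const, h.mean]

/-- A letter that occurs once in the word and does not influence `H` enters the integrand linearly,
so it may be averaged to σ. The prefix `u` holds the part already processed, which lets the
induction run over `w`. -/
theorem IsEstimator.integral_trace_mul_eraseLetters (h : IsEstimator μ X σ) (T : Finset κ)
    {H : (κ → Ω) → ℂ} (hH : BddMeas H)
    (hT : ∀ i ∈ T, ∀ x ω, H (Function.update x i ω) = H x)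
    (u w : List (Option κ)) (hw : (u ++ w).reduceOption.Nodup) :
    ∫ x, (wordVal X σ x (u ++ w)).trace * H x ∂(Measure.pi fun _ => μ) =
      ∫ x, (wordVal X σ x (u ++ w.map (eraseLetters T))).trace * H x
        ∂(Measure.pi fun _ => μ) := by
  induction w generalizing u with
  | nil => simp
  | cons o w ih =>
    have happ : ∀ (o : Option κ) (v : List (Option κ)), u ++ o :: v = (u ++ [o]) ++ v := by simp
    by_cases ho : eraseLetters T o = o
    · rw [List.map_cons, ho, happ, happ o (w.map _), ih _ (by simpa using hw)]
    · cases o with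
      | none => exact absurd rfl ho
      | some i =>
        have hi : i ∈ T := by
          by_contra hi
          exact ho (by simp [eraseLetters, hi])
        have hnone : eraseLetters T (some i) = none := by simp [eraseLetters, hi]
        have hnd : i ∉ u.reduceOption ∧ i ∉ w.reduceOption := by
          rw [List.reduceOption_append, List.reduceOption_cons_of_some,
            List.nodup_middle, List.nodup_cons, List.mem_append, not_or] at hw
          exact hw.1
        have hnd' : ((u ++ [none]) ++ w).reduceOption.Nodup := by
          rw [List.reduceOption_append, List.reduceOption_cons_of_some,
            List.nodup_middle, List.nodup_cons] at hw
          simpa [List.reduceOption_append, List.reduceOption_cons_of_none] using hw.2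
        -- The induction hypothesis is used backwards, so that the two sides differ only in the
        -- single letter `i`.
        rw [List.map_cons, hnone, happ none, ← ih _ hnd']
        have hmeas : ∀ v : List (Option κ),
            BddMeas fun x : κ → Ω => (wordVal X σ x v).trace * H x := fun v =>
          (bddMeas_wordVal h.bddMeas v).trace.mul hH
        rw [integral_pi_eq_integral_update μ i (hmeas _)]
        refine integral_congr_ae (Filter.Eventually.of_forall fun x => ?_)
        simp only [hT i hi, wordVal_append, wordVal_cons_some, wordVal_cons_none, wordVal_nil,
          wordVal_update _ _ hnd.1, wordVal_update _ _ hnd.2, Function.update_self, mul_one]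
        have := h.integral_linear ((LinearMap.mul ℂ ℂ).flip (H x) ∘ₗ Matrix.traceLinearMap ι ℂ ℂ ∘ₗ
          LinearMap.mulLeft ℂ (wordVal X σ x u) ∘ₗ LinearMap.mulRight ℂ (wordVal X σ x w))
        simpa [mul_assoc, mul_comm (H x)] using this

end Words

/-! ### Counting injective tuples by overlap -/

section Counting

/-- Factor by factor this is (r - m)/r ≤ (n - m)/n. Truncated subtraction is harmless, being
monotone. -/
theorem descFactorial_mul_pow_le {r n : ℕ} (h : r ≤ n) (m : ℕ) :
    r.descFactorial m * n ^ m ≤ n.descFactorial m * r ^ m := by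
  induction m with
  | zero => simp
  | succ m ih =>
    rw [Nat.descFactorial_succ, Nat.descFactorial_succ, pow_succ, pow_succ]
    have h1 : (r - m) * n ≤ (n - m) * r := by
      rw [Nat.sub_mul, Nat.sub_mul, mul_comm n r]
      exact Nat.sub_le_sub_left (Nat.mul_le_mul_left m h) _
    calc (r - m) * r.descFactorial m * (n ^ m * n)
        = ((r - m) * n) * (r.descFactorial m * n ^ m) := by ring
      _ ≤ ((n - m) * r) * (n.descFactorial m * r ^ m) := Nat.mul_le_mul h1 ih
      _ = _ := by ring

variable {α β : Type*} [Fintype α] [Fintype β] [DecidableEq α] [DecidableEq β]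

/-- Among all embeddings `α ↪ β`, the proportion of those that map `A` into `R` is at most
`(|R| / |β|) ^ |A|`. -/
theorem card_embedding_mapsTo_mul_le (A : Finset α) (R : Finset β) :
    (Finset.univ.filter fun j : α ↪ β => ∀ a ∈ A, j a ∈ R).card * Fintype.card β ^ A.card ≤
      (Fintype.card β).descFactorial (Fintype.card α) * R.card ^ A.card := by
  set res : (α ↪ β) → ({a // a ∈ A} ↪ β) := fun j => (Function.Embedding.subtype _).trans j
    with hres
  set t : Finset ({a // a ∈ A} ↪ β) := Finset.univ.filter fun f => ∀ a, f a ∈ R with ht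
  have htcard : t.card ≤ R.card.descFactorial A.card := by
    have h1 : t.card = Fintype.card {f : {a // a ∈ A} ↪ β // ∀ a, f a ∈ R} := by
      rw [Fintype.card_subtype]
    have h2 : Fintype.card {f : {a // a ∈ A} ↪ β // ∀ a, f a ∈ R} ≤
        Fintype.card ({a // a ∈ A} ↪ {b // b ∈ R}) := by
      refine Fintype.card_le_of_injective
        (fun f => f.1.codRestrict (R : Set β) f.2) fun f g hfg => ?_
      ext a
      have := congrArg (fun e : {a // a ∈ A} ↪ {b // b ∈ R} => (e a : β)) hfg
      exact this
    rw [Fintype.card_embedding_eq, Fintype.card_coe, Fintype.card_coe] at h2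
    exact h1.trans_le h2
  -- An embedding is its restriction to `A`, one of at most (|R|)_{|A|} choices, together with an
  -- extension: the points outside `A` must avoid the image of the restriction.
  have hmain : (Finset.univ.filter fun j : α ↪ β => ∀ a ∈ A, j a ∈ R).card ≤
      (Fintype.card β - A.card).descFactorial (Fintype.card α - A.card) * t.card := by
    refine Finset.card_le_mul_card_image_of_maps_to (f := res) (fun j hj => ?_) _ fun f _ => ?_
    · simp only [Finset.mem_filter, Finset.mem_univ, true_and, ht] at hj ⊢
      exact fun a => hj a.1 a.2
    · set U : Finset β := Finset.univ.map f with hU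
      have hUc : U.card = A.card := by simp [hU]
      have key : (Finset.univ.filter fun j : α ↪ β => res j = f).card ≤
          Fintype.card ({a // a ∈ Aᶜ} ↪ {b // b ∈ Uᶜ}) := by
        rw [← Fintype.card_subtype]
        refine Fintype.card_le_of_injective (fun j : {j : α ↪ β // res j = f} =>
          (⟨fun a => ⟨j.1 a.1, ?_⟩, fun a b hab => ?_⟩ : {a // a ∈ Aᶜ} ↪ {b // b ∈ Uᶜ})) ?_
        · rw [Finset.mem_compl, hU, Finset.mem_map]
          rintro ⟨b, _, hb⟩
          have hjb : j.1 b = f b := DFunLike.congr_fun j.2 b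
          have hba : (b : α) = a := j.1.injective (hjb.trans hb)
          exact (Finset.mem_compl.1 a.2) (hba ▸ b.2)
        · exact Subtype.ext (j.1.injective (Subtype.ext_iff.1 hab))
        · intro j j' hjj
          refine Subtype.ext (DFunLike.ext _ _ fun a => ?_)
          by_cases ha : a ∈ A
          · have := congrArg (fun e : {a // a ∈ A} ↪ β => e ⟨a, ha⟩) (j.2.trans j'.2.symm)
            exact this
          · have := congrArg (fun e : {a // a ∈ Aᶜ} ↪ {b // b ∈ Uᶜ} =>
              (e ⟨a, Finset.mem_compl.2 ha⟩ : β)) hjj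
            exact this
      rw [Fintype.card_embedding_eq, Fintype.card_coe, Fintype.card_coe, Finset.card_compl,
        Finset.card_compl, hUc] at key
      refine le_trans (Finset.card_le_card fun j hj => ?_) key
      simp only [Finset.mem_filter, Finset.mem_univ, true_and] at hj ⊢
      exact hj.2
  calc _ ≤ ((Fintype.card β - A.card).descFactorial (Fintype.card α - A.card) *
          R.card.descFactorial A.card) * Fintype.card β ^ A.card :=
        Nat.mul_le_mul_right _ (hmain.trans (Nat.mul_le_mul_left _ htcard))
    _ = (Fintype.card β - A.card).descFactorial (Fintype.card α - A.card) *
          (R.card.descFactorial A.card * Fintype.card β ^ A.card) := by ring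
    _ ≤ (Fintype.card β - A.card).descFactorial (Fintype.card α - A.card) *
          ((Fintype.card β).descFactorial A.card * R.card ^ A.card) :=
        Nat.mul_le_mul_left _ (descFactorial_mul_pow_le (Finset.card_le_univ R) _)
    _ = _ := by
        rw [← mul_assoc, Nat.descFactorial_mul_descFactorial (Finset.card_le_univ A)]

/-- Sort the embeddings `j` by the set `A` of positions landing in the image of `i`; the overlap is
then |A|. Requiring only that `A` lands in the image enlarges each class to one of proportion at
most (k/n)^|A|, and there are C(k,m) sets `A` of size `m`. -/
theorem sum_card_map_inter_map_le [Nonempty β] (i : α ↪ β) {g : ℕ → ℝ} (hg : ∀ m, 0 ≤ g m) :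
    ∑ j : α ↪ β, g (Finset.univ.map i ∩ Finset.univ.map j).card ≤
      (Fintype.card β).descFactorial (Fintype.card α) *
        ∑ m ∈ Finset.range (Fintype.card α + 1), (Fintype.card α).choose m *
          (g m * ((Fintype.card α : ℝ) / Fintype.card β) ^ m) := by
  set R : Finset β := Finset.univ.map i with hR
  have hRc : R.card = Fintype.card α := by simp [hR]
  have hov : ∀ j : α ↪ β, (R ∩ Finset.univ.map j).card =
      (Finset.univ.filter fun a => j a ∈ R).card := fun j => by
    rw [← Finset.card_map j]
    congr 1
    ext b
    simp only [Finset.mem_inter, Finset.mem_map, Finset.mem_univ, true_and, Finset.mem_filter]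
    constructor
    · rintro ⟨hb, a, rfl⟩
      exact ⟨a, hb, rfl⟩
    · rintro ⟨a, ha, rfl⟩
      exact ⟨ha, a, rfl⟩
  simp only [hov]
  have hβ : (0 : ℝ) < Fintype.card β := by exact_mod_cast Fintype.card_pos
  calc ∑ j : α ↪ β, g (Finset.univ.filter fun a => j a ∈ R).card
      = ∑ A : Finset α, ∑ j : α ↪ β with (Finset.univ.filter fun a => j a ∈ R) = A,
          g (Finset.univ.filter fun a => j a ∈ R).card :=
        (Finset.sum_fiberwise _ _ _).symm
    _ ≤ ∑ A : Finset α, (Fintype.card β).descFactorial (Fintype.card α) *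
          (g A.card * ((Fintype.card α : ℝ) / Fintype.card β) ^ A.card) := by
        refine Finset.sum_le_sum fun A _ => ?_
        have h1 : ∑ j : α ↪ β with (Finset.univ.filter fun a => j a ∈ R) = A,
            g (Finset.univ.filter fun a => j a ∈ R).card =
            (Finset.univ.filter fun j : α ↪ β =>
              (Finset.univ.filter fun a => j a ∈ R) = A).card * g A.card := by
          rw [← nsmul_eq_mul]
          refine Finset.sum_eq_card_nsmul fun j hj => ?_
          rw [(Finset.mem_filter.1 hj).2]
        have h2 : (Finset.univ.filter fun j : α ↪ β =>
              (Finset.univ.filter fun a => j a ∈ R) = A).card ≤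
            (Finset.univ.filter fun j : α ↪ β => ∀ a ∈ A, j a ∈ R).card := by
          refine Finset.card_le_card fun j hj => ?_
          simp only [Finset.mem_filter, Finset.mem_univ, true_and] at hj ⊢
          intro a ha
          rw [← hj] at ha
          exact (Finset.mem_filter.1 ha).2
        have h3 : ((Finset.univ.filter fun j : α ↪ β => ∀ a ∈ A, j a ∈ R).card : ℝ) *
            (Fintype.card β : ℝ) ^ A.card ≤
            (Fintype.card β).descFactorial (Fintype.card α) * (Fintype.card α : ℝ) ^ A.card := by
          have := card_embedding_mapsTo_mul_le A R
          rw [hRc] at this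
          exact_mod_cast this
        rw [h1]
        calc _ ≤ ((Finset.univ.filter fun j : α ↪ β => ∀ a ∈ A, j a ∈ R).card : ℝ) * g A.card :=
              mul_le_mul_of_nonneg_right (by exact_mod_cast h2) (hg _)
          _ ≤ ((Fintype.card β).descFactorial (Fintype.card α) * (Fintype.card α : ℝ) ^ A.card /
                (Fintype.card β : ℝ) ^ A.card) * g A.card :=
              mul_le_mul_of_nonneg_right ((le_div_iff₀ (by positivity)).2 h3) (hg _)
          _ = _ := by
              rw [div_pow]
              ring
    _ = _ := by
        rw [← Finset.mul_sum, ← Finset.powerset_univ,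
          Finset.sum_powerset_apply_card (fun m => g m * ((Fintype.card α : ℝ) /
            Fintype.card β) ^ m), Finset.card_univ]
        simp only [nsmul_eq_mul]

end Counting

/-! ### Mean and variance of the trace U-statistic -/

section UStatistic

variable {ι κ Ω : Type*} [Fintype ι] [DecidableEq ι] [MeasurableSpace Ω]
  {X : Ω → Matrix ι ι ℂ} {σ : Matrix ι ι ℂ} {n k : ℕ}

/-- The word `X_{i₁} ⋯ X_{i_k}`. -/
def tupleWord (i : Fin k ↪ Fin n) : List (Option (Fin n)) := (List.ofFn i).map some

omit [MeasurableSpace Ω] in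
theorem wordVal_tupleWord (x : Fin n → Ω) (i : Fin k ↪ Fin n) :
    wordVal X σ x (tupleWord i) = (List.ofFn fun a => X (x (i a))).prod := by
  simp [wordVal, tupleWord, List.map_ofFn, Function.comp_def]

theorem reduceOption_map_some {γ : Type*} (l : List γ) : (l.map some).reduceOption = l := by
  simp [List.reduceOption, List.filterMap_map]

theorem reduceOption_map_eraseLetters [DecidableEq κ] (T : Finset κ) (l : List κ) :
    ((l.map some).map (eraseLetters T)).reduceOption = l.filter (· ∉ T) := by
  induction l with
  | nil => rfl
  | cons i l ih =>
    by_cases hi : i ∈ T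
    · simp_all [eraseLetters, List.reduceOption_cons_of_none, Option.filter]
    · simp_all [eraseLetters, List.reduceOption_cons_of_some, Option.filter]

theorem length_reduceOption_add_count_none [DecidableEq κ] (w : List (Option κ)) :
    w.reduceOption.length + w.count none = w.length := by
  induction w with
  | nil => rfl
  | cons o w ih =>
    cases o with
    | none =>
      rw [List.reduceOption_cons_of_none, List.count_cons_self, List.length_cons]
      omega
    | some i =>
      rw [List.reduceOption_cons_of_some, List.count_cons_of_ne (by simp), List.length_cons,
        List.length_cons]
      omega

theorem nodup_tupleWord (i : Fin k ↪ Fin n) : (tupleWord i).reduceOption.Nodup := by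
  rw [tupleWord, reduceOption_map_some]
  exact List.nodup_ofFn.2 i.injective

theorem mem_reduceOption_tupleWord (i : Fin k ↪ Fin n) (l : Fin n) :
    l ∈ (tupleWord i).reduceOption ↔ l ∈ Finset.univ.map i := by
  rw [tupleWord, reduceOption_map_some, List.mem_ofFn']
  simp

/-- The word of the tuple `i` in which only the letters shared with `j` stay random. -/
def sharedWord (i j : Fin k ↪ Fin n) : List (Option (Fin n)) :=
  (tupleWord i).map (eraseLetters (Finset.univ.map j)ᶜ)

theorem reduceOption_sharedWord (i j : Fin k ↪ Fin n) :
    (sharedWord i j).reduceOption = (List.ofFn i).filter (· ∈ Finset.univ.map j) := by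
  rw [sharedWord, tupleWord, reduceOption_map_eraseLetters]
  simp

theorem nodup_sharedWord (i j : Fin k ↪ Fin n) : (sharedWord i j).reduceOption.Nodup := by
  rw [reduceOption_sharedWord]
  exact (List.nodup_ofFn.2 i.injective).filter _

theorem length_reduceOption_sharedWord (i j : Fin k ↪ Fin n) :
    (sharedWord i j).reduceOption.length = (Finset.univ.map i ∩ Finset.univ.map j).card := by
  rw [← List.toFinset_card_of_nodup (nodup_sharedWord i j), reduceOption_sharedWord]
  congr 1
  ext l
  simp [List.mem_ofFn']

theorem count_none_sharedWord (i j : Fin k ↪ Fin n) :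
    (sharedWord i j).count none = k - (Finset.univ.map i ∩ Finset.univ.map j).card := by
  have h := length_reduceOption_add_count_none (sharedWord i j)
  rw [length_reduceOption_sharedWord] at h
  have hl : (sharedWord i j).length = k := by simp [sharedWord, tupleWord]
  omega

omit [MeasurableSpace Ω] in
theorem wordVal_of_reduceOption_eq_nil (x : κ → Ω) (w : List (Option κ))
    (hw : w.reduceOption = []) : wordVal X σ x w = σ ^ w.length := by
  induction w with
  | nil => simp [wordVal_nil]
  | cons o w ih =>
    cases o with
    | none =>
      rw [List.reduceOption_cons_of_none] at hw
      rw [wordVal_cons_none, ih hw, List.length_cons, pow_succ']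
    | some i =>
      rw [List.reduceOption_cons_of_some] at hw
      exact absurd hw (by simp)

variable {μ : Measure Ω} [IsProbabilityMeasure μ]

theorem IsEstimator.integral_trace_tuple (h : IsEstimator μ X σ) (i : Fin k ↪ Fin n) :
    ∫ x, (wordVal X σ x (tupleWord i)).trace ∂(Measure.pi fun _ => μ) = (σ ^ k).trace := by
  have h1 := h.integral_trace_mul_eraseLetters Finset.univ (H := fun _ => (1 : ℂ))
    (BddMeas.const 1) (fun _ _ _ _ => rfl) [] (tupleWord i) (nodup_tupleWord i)
  have h2 : ((tupleWord i).map (eraseLetters Finset.univ)).reduceOption = [] := by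
    rw [tupleWord, reduceOption_map_eraseLetters]
    simp
  simp only [List.nil_append, mul_one, wordVal_of_reduceOption_eq_nil _ _ h2] at h1
  rw [h1]
  simp [tupleWord]

/-- The letters absent from `j` are averaged with the second trace held as a factor. Then the
letters absent from `i` are averaged; the first factor, by now a shared word, still contains only
letters of `i`. -/
theorem IsEstimator.integral_trace_tuple_mul (h : IsEstimator μ X σ) (i j : Fin k ↪ Fin n) :
    ∫ x, (wordVal X σ x (tupleWord i)).trace * (wordVal X σ x (tupleWord j)).trace
        ∂(Measure.pi fun _ => μ) =
      ∫ x, (wordVal X σ x (sharedWord i j)).trace * (wordVal X σ x (sharedWord j i)).trace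
        ∂(Measure.pi fun _ => μ) := by
  have h1 := h.integral_trace_mul_eraseLetters (Finset.univ.map j)ᶜ
    (H := fun x => (wordVal X σ x (tupleWord j)).trace)
    (bddMeas_wordVal h.bddMeas _).trace (fun l hl x ω => by
      rw [wordVal_update]
      rwa [mem_reduceOption_tupleWord, ← Finset.mem_compl]) [] (tupleWord i) (nodup_tupleWord i)
  have h2 := h.integral_trace_mul_eraseLetters (Finset.univ.map i)ᶜ
    (H := fun x => (wordVal X σ x (sharedWord i j)).trace)
    (bddMeas_wordVal h.bddMeas _).trace (fun l hl x ω => by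
      rw [wordVal_update]
      rw [reduceOption_sharedWord]
      simp only [List.mem_filter, List.mem_ofFn', Finset.mem_compl, Finset.mem_map] at hl ⊢
      rintro ⟨⟨a, rfl⟩, -⟩
      exact hl ⟨a, Finset.mem_univ a, rfl⟩) [] (tupleWord j) (nodup_tupleWord j)
  simp only [List.nil_append] at h1 h2
  rw [h1]
  simp only [mul_comm _ (wordVal X σ _ (tupleWord j)).trace]
  rw [← sharedWord, h2, ← sharedWord]
  simp only [mul_comm]

/-- Bound for the covariance of two tuples that share `m` indices. -/
noncomputable def covBound (σ : Matrix ι ι ℂ) (k m : ℕ) : ℝ :=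
  if m = 0 then 0 else
    3 ^ m * (Fintype.card ι : ℝ) ^ (m - 1) * (σ ^ (2 * (k - m))).trace.re

theorem covBound_nonneg (hσ : σ.PosSemidef) (k m : ℕ) : 0 ≤ covBound σ k m := by
  unfold covBound
  split_ifs
  · exact le_rfl
  · have := re_trace_pow_nonneg hσ (2 * (k - m))
    positivity

/-- Without overlap both shared words are the constant σ^k. With overlap, Re(zw) ≤ (|z|² + |w|²)/2
separates two words with the same number of random letters. -/
theorem IsEstimator.re_integral_tuple_mul_le (h : IsEstimator μ X σ) (hσ : σ.PosSemidef)
    (i j : Fin k ↪ Fin n) :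
    (∫ x, (wordVal X σ x (tupleWord i)).trace * (wordVal X σ x (tupleWord j)).trace
        ∂(Measure.pi fun _ => μ)).re ≤
      (σ ^ k).trace.re ^ 2 + covBound σ k (Finset.univ.map i ∩ Finset.univ.map j).card := by
  rw [h.integral_trace_tuple_mul]
  by_cases h0 : (Finset.univ.map i ∩ Finset.univ.map j).card = 0
  · have h1 : (sharedWord i j).reduceOption = [] := by
      rw [← List.length_eq_zero_iff, length_reduceOption_sharedWord, h0]
    have h2 : (sharedWord j i).reduceOption = [] := by
      rw [← List.length_eq_zero_iff, length_reduceOption_sharedWord, Finset.inter_comm, h0]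
    simp only [wordVal_of_reduceOption_eq_nil _ _ h1, wordVal_of_reduceOption_eq_nil _ _ h2,
      integral_const, probReal_univ, one_smul]
    have hl : ∀ i j : Fin k ↪ Fin n, (sharedWord i j).length = k := by
      simp [sharedWord, tupleWord]
    rw [hl, hl, trace_pow_eq_re hσ, ← Complex.ofReal_mul, Complex.ofReal_re, Complex.ofReal_re,
      covBound, if_pos h0, add_zero, sq]
  · have hb : ∀ i j : Fin k ↪ Fin n, (Finset.univ.map i ∩ Finset.univ.map j).card ≠ 0 →
        ∫ x, ‖(wordVal X σ x (sharedWord i j)).trace‖ ^ 2 ∂(Measure.pi fun _ => μ) ≤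
          covBound σ k (Finset.univ.map i ∩ Finset.univ.map j).card := fun i j h0 => by
      have h1 := h.integral_norm_trace_sq_le hσ (sharedWord i j) (nodup_sharedWord i j) (by
        rw [ne_eq, ← List.length_eq_zero_iff, length_reduceOption_sharedWord]
        exact h0)
      rw [length_reduceOption_sharedWord, count_none_sharedWord] at h1
      rwa [covBound, if_neg h0]
    have hi := hb i j h0
    have hj := hb j i (by rwa [Finset.inter_comm])
    rw [Finset.inter_comm] at hj
    have hm : ∀ i j : Fin k ↪ Fin n,
        BddMeas fun x : Fin n → Ω => (wordVal X σ x (sharedWord i j)).trace := fun i j =>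
      (bddMeas_wordVal h.bddMeas _).trace
    have hre := (integral_re (𝕜 := ℂ) (((hm i j).mul (hm j i)).integrable
      (Measure.pi fun _ => μ))).symm
    have hint : ∫ x, ((wordVal X σ x (sharedWord i j)).trace *
          (wordVal X σ x (sharedWord j i)).trace).re ∂(Measure.pi fun _ => μ) ≤
        ∫ x, (1 / 2 * ‖(wordVal X σ x (sharedWord i j)).trace‖ ^ 2 +
          1 / 2 * ‖(wordVal X σ x (sharedWord j i)).trace‖ ^ 2) ∂(Measure.pi fun _ => μ) := by
      refine integral_mono (((hm i j).mul (hm j i)).re.integrable _)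
        ((((hm i j).norm_sq.integrable _).const_mul _).add
          (((hm j i).norm_sq.integrable _).const_mul _)) fun x => ?_
      refine (Complex.re_le_norm _).trans ?_
      rw [norm_mul]
      nlinarith [sq_nonneg (‖(wordVal X σ x (sharedWord i j)).trace‖ -
        ‖(wordVal X σ x (sharedWord j i)).trace‖)]
    rw [integral_add (((hm i j).norm_sq.integrable _).const_mul _)
      (((hm j i).norm_sq.integrable _).const_mul _), integral_const_mul, integral_const_mul]
      at hint
    -- The bound on the product already holds without the squared mean, which may be added because
    -- it is nonnegative.
    have := sq_nonneg (σ ^ k).trace.re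
    refine (le_of_eq hre).trans (hint.trans ?_)
    linarith

/-- The `U`-statistic of the kernel `tr (X₁ ⋯ X_k)`. -/
noncomputable def traceUStat (X : Ω → Matrix ι ι ℂ) (n k : ℕ) (x : Fin n → Ω) : ℂ :=
  (n.descFactorial k : ℂ)⁻¹ * ∑ i : Fin k ↪ Fin n, (List.ofFn fun a => X (x (i a))).prod.trace

omit [DecidableEq ι] [MeasurableSpace Ω] in
theorem star_trace_list_prod [DecidableEq ι] (l : List (Matrix ι ι ℂ))
    (hl : ∀ A ∈ l, A.IsHermitian) : star l.prod.trace = l.reverse.prod.trace := by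
  rw [← Matrix.trace_conjTranspose, Matrix.conjTranspose_list_prod]
  congr 2
  refine congrArg List.reverse (Eq.trans (List.map_congr_left fun A hA => ?_) (List.map_id l))
  exact (hl A hA).eq

omit [MeasurableSpace Ω] in
-- Conjugation reverses each product of Hermitian factors, and reversing the tuples permutes the
-- index set of the sum.
theorem traceUStat_im (hX : ∀ ω, (X ω).IsHermitian) (x : Fin n → Ω) :
    (traceUStat X n k x).im = 0 := by
  rw [← Complex.conj_eq_iff_im]
  unfold traceUStat
  rw [map_mul, map_inv₀, map_natCast, map_sum]
  congr 1
  refine Fintype.sum_equiv (Equiv.embeddingCongr Fin.revPerm (Equiv.refl _)) _ _ fun i => ?_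
  rw [starRingEnd_apply, star_trace_list_prod _ (by
    intro A hA
    obtain ⟨a, rfl⟩ := (List.mem_ofFn' _ _).1 hA
    exact hX _)]
  congr 2
  refine List.ext_getElem (by simp) fun p hp _ => ?_
  simp only [List.getElem_reverse, List.getElem_ofFn, List.length_ofFn]
  refine congrArg (fun a => X (x (i a))) (Fin.ext ?_)
  simp only [List.length_reverse, List.length_ofFn] at hp
  simp [Fin.val_rev]
  omega

omit [MeasurableSpace Ω] [IsProbabilityMeasure μ] in
theorem traceUStat_eq (σ : Matrix ι ι ℂ) (x : Fin n → Ω) : traceUStat X n k x =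
    (n.descFactorial k : ℂ)⁻¹ * ∑ i : Fin k ↪ Fin n, (wordVal X σ x (tupleWord i)).trace := by
  simp only [wordVal_tupleWord, traceUStat]

theorem bddMeas_traceUStat (hX : MatBddMeas X) : BddMeas (traceUStat X n k) := by
  have : traceUStat X n k = fun x => (n.descFactorial k : ℂ)⁻¹ *
      ∑ i : Fin k ↪ Fin n, (wordVal X 0 x (tupleWord i)).trace := funext fun x => traceUStat_eq 0 x
  rw [this]
  exact (BddMeas.const _).mul (BddMeas.sum fun i _ => (bddMeas_wordVal hX _).trace)

theorem IsEstimator.integral_traceUStat (h : IsEstimator μ X σ) (hkn : k ≤ n) :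
    ∫ x, traceUStat X n k x ∂(Measure.pi fun _ => μ) = (σ ^ k).trace := by
  simp only [traceUStat_eq σ]
  rw [integral_const_mul, integral_finsetSum _ fun i _ =>
    (bddMeas_wordVal h.bddMeas _).trace.integrable _]
  simp only [h.integral_trace_tuple, Finset.sum_const, Finset.card_univ,
    Fintype.card_embedding_eq, Fintype.card_fin, nsmul_eq_mul]
  rw [inv_mul_cancel_left₀]
  exact_mod_cast (Nat.descFactorial_pos.2 hkn).ne'

theorem IsEstimator.variance_traceUStat_le (h : IsEstimator μ X σ) (hσ : σ.PosSemidef)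
    (hn : 0 < n) (hkn : k ≤ n) :
    ProbabilityTheory.variance (fun x => (traceUStat X n k x).re) (Measure.pi fun _ => μ) ≤
      ∑ m ∈ Finset.range (k + 1), k.choose m * (covBound σ k m * ((k : ℝ) / n) ^ m) := by
  have hB : BddMeas (traceUStat X n k) := bddMeas_traceUStat h.bddMeas
  set P : Measure (Fin n → Ω) := Measure.pi fun _ => μ with hP
  set N : ℝ := (n.descFactorial k : ℝ) with hN
  have hNpos : 0 < N := Nat.cast_pos.2 (Nat.descFactorial_pos.2 hkn)
  rw [ProbabilityTheory.variance_eq_sub (hB.re.memLp _ 2)]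
  have hmean : ∫ x, (traceUStat X n k x).re ∂P = (σ ^ k).trace.re := by
    rw [← h.integral_traceUStat hkn]
    exact integral_re (𝕜 := ℂ) (hB.integrable P)
  -- Since the statistic is real, its square needs no conjugate and expands as a plain double sum
  -- over tuples.
  have hsq : ∫ x, (traceUStat X n k x).re ^ 2 ∂P =
      (∫ x, traceUStat X n k x * traceUStat X n k x ∂P).re := by
    refine Eq.trans ?_ (integral_re (𝕜 := ℂ) ((hB.mul hB).integrable P))
    refine integral_congr_ae (Filter.Eventually.of_forall fun x => ?_)
    simp [sq, traceUStat_im h.isHermitian x]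
  have hF : ∀ i : Fin k ↪ Fin n,
      BddMeas fun x : Fin n → Ω => (wordVal X σ x (tupleWord i)).trace := fun i =>
    (bddMeas_wordVal h.bddMeas _).trace
  have hexp : (∫ x, traceUStat X n k x * traceUStat X n k x ∂P).re =
      (N⁻¹) ^ 2 * ∑ i : Fin k ↪ Fin n, ∑ j : Fin k ↪ Fin n,
        (∫ x, (wordVal X σ x (tupleWord i)).trace * (wordVal X σ x (tupleWord j)).trace ∂P).re := by
    have h1 : ∀ x, traceUStat X n k x * traceUStat X n k x = (((N⁻¹) ^ 2 : ℝ) : ℂ) *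
        ∑ i : Fin k ↪ Fin n, ∑ j : Fin k ↪ Fin n,
          (wordVal X σ x (tupleWord i)).trace * (wordVal X σ x (tupleWord j)).trace := fun x => by
      rw [traceUStat_eq σ, ← Finset.sum_mul_sum, hN]
      push_cast
      ring
    simp only [h1]
    rw [integral_const_mul, Complex.re_ofReal_mul, integral_finsetSum _ fun i _ =>
      (BddMeas.sum fun j _ => (hF i).mul (hF j)).integrable P, Complex.re_sum]
    congr 1
    refine Finset.sum_congr rfl fun i _ => ?_
    rw [integral_finsetSum _ fun j _ => ((hF i).mul (hF j)).integrable P, Complex.re_sum]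
  have hcard : (Fintype.card (Fin k ↪ Fin n) : ℝ) = N := by
    rw [Fintype.card_embedding_eq, Fintype.card_fin, Fintype.card_fin]
  have : Nonempty (Fin n) := ⟨⟨0, hn⟩⟩
  set S : ℝ := ∑ m ∈ Finset.range (k + 1), k.choose m * (covBound σ k m * ((k : ℝ) / n) ^ m)
    with hS
  have hbound : ∑ i : Fin k ↪ Fin n, ∑ j : Fin k ↪ Fin n,
        (∫ x, (wordVal X σ x (tupleWord i)).trace * (wordVal X σ x (tupleWord j)).trace ∂P).re ≤
      N * (N * (σ ^ k).trace.re ^ 2 + N * S) := by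
    calc _ ≤ ∑ i : Fin k ↪ Fin n, (N * (σ ^ k).trace.re ^ 2 + N * S) := by
          refine Finset.sum_le_sum fun i _ => ?_
          refine (Finset.sum_le_sum fun j _ => h.re_integral_tuple_mul_le hσ i j).trans ?_
          rw [Finset.sum_add_distrib, Finset.sum_const, Finset.card_univ, nsmul_eq_mul, hcard]
          have h2 := sum_card_map_inter_map_le i (covBound_nonneg hσ k)
          simp only [Fintype.card_fin] at h2
          exact add_le_add le_rfl h2
      _ = _ := by rw [Finset.sum_const, Finset.card_univ, nsmul_eq_mul, hcard]
  have hmean2 : (fun x => (traceUStat X n k x).re ^ 2) =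
      (fun x => (traceUStat X n k x).re) ^ 2 := rfl
  rw [← hmean2, hsq, hmean, hexp]
  have h3 := mul_le_mul_of_nonneg_left hbound (sq_nonneg N⁻¹)
  have h4 : N⁻¹ ^ 2 * (N * (N * (σ ^ k).trace.re ^ 2 + N * S)) = (σ ^ k).trace.re ^ 2 + S := by
    field_simp
  linarith

/-- With `m = k - j`, the bounds C(k,m) ≤ 2^k and 3^m ≤ 3^k produce 6^k, while d^{m-1}(k/n)^m =
(kd/n)^m / d. -/
theorem sum_choose_mul_covBound_le [Nonempty ι] (hσ : σ.PosSemidef) (n k : ℕ) :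
    ∑ m ∈ Finset.range (k + 1), k.choose m * (covBound σ k m * ((k : ℝ) / n) ^ m) ≤
      6 ^ k / (Fintype.card ι : ℝ) * ∑ j ∈ Finset.range k,
        ((k : ℝ) * Fintype.card ι / n) ^ (k - j) * (σ ^ (2 * j)).trace.re := by
  have hd : (0 : ℝ) < Fintype.card ι := by exact_mod_cast Fintype.card_pos
  -- The term `m = 0` is split off, where `covBound` vanishes, and the others are reversed so that
  -- `m` becomes `k - j`.
  rw [Finset.sum_range_succ', ← Finset.sum_range_reflect, Finset.mul_sum]
  simp only [covBound, if_pos, zero_mul, mul_zero, add_zero]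
  refine Finset.sum_le_sum fun j hj => ?_
  have hj := Finset.mem_range.1 hj
  obtain ⟨m, rfl⟩ : ∃ m, k = j + (m + 1) := ⟨k - 1 - j, by omega⟩
  have e1 : j + (m + 1) - 1 - j + 1 = m + 1 := by omega
  have e2 : j + (m + 1) - (m + 1) = j := by omega
  have e3 : j + (m + 1) - j = m + 1 := by omega
  rw [e1, e2, e3, if_neg (Nat.succ_ne_zero m), Nat.add_sub_cancel]
  set k := j + (m + 1) with hk
  have hT := re_trace_pow_nonneg hσ (2 * j)
  have h1 : ((k.choose (m + 1) : ℕ) : ℝ) ≤ 2 ^ k := by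
    exact_mod_cast Nat.choose_le_two_pow k (m + 1)
  have h2 : (3 : ℝ) ^ (m + 1) ≤ 3 ^ k := pow_le_pow_right₀ (by norm_num) (by omega)
  have h6 : (6 : ℝ) ^ k = 2 ^ k * 3 ^ k := by rw [← mul_pow]; norm_num
  calc (k.choose (m + 1) : ℝ) * (3 ^ (m + 1) * (Fintype.card ι : ℝ) ^ m *
          (σ ^ (2 * j)).trace.re * ((k : ℝ) / n) ^ (m + 1))
      ≤ 2 ^ k * (3 ^ k * (Fintype.card ι : ℝ) ^ m *
          (σ ^ (2 * j)).trace.re * ((k : ℝ) / n) ^ (m + 1)) := by gcongr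
    _ = _ := by
        rw [h6, mul_div_right_comm (k : ℝ), mul_pow (_ / _) (Fintype.card ι : ℝ),
          pow_succ (Fintype.card ι : ℝ) m]
        field_simp

end UStatistic

/-! ### Invariance and third moments of the uniform measure on unit vectors -/

section Haar

variable {d : ℕ}

instance isProbabilityMeasure_haarUnit [NeZero d] : IsProbabilityMeasure (haarUnit d) := by
  refine ⟨?_⟩
  have : Nontrivial (EuclideanSpace ℂ (Fin d)) := by
    have : Nonempty (Fin d) := ⟨0⟩
    exact inferInstanceAs (Nontrivial (PiLp 2 fun _ : Fin d => ℂ))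
  have h := Measure.toSphere_ne_zero (volume : Measure (EuclideanSpace ℂ (Fin d)))
  rw [haarUnit, Measure.smul_apply, smul_eq_mul]
  exact ENNReal.inv_mul_cancel (Measure.measure_univ_ne_zero.2 h) (measure_ne_top _ _)

/-- The action of a linear isometry on the unit sphere. -/
noncomputable def sphereMap (f : EuclideanSpace ℂ (Fin d) ≃ₗᵢ[ℝ] EuclideanSpace ℂ (Fin d)) (u : UnitVec d) :
    UnitVec d :=
  ⟨f u.1, by simp⟩

open scoped Pointwise in
-- The surface measure of a set is, up to a constant, the volume of the cone over it; a linear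
-- isometry carries cones to cones and preserves volume.
theorem measurePreserving_sphereMap
    (f : EuclideanSpace ℂ (Fin d) ≃ₗᵢ[ℝ] EuclideanSpace ℂ (Fin d)) :
    MeasurePreserving (sphereMap f) (haarUnit d) (haarUnit d) := by
  have hc : Continuous (sphereMap f) := by
    unfold sphereMap
    exact Continuous.subtype_mk (f.continuous.comp continuous_subtype_val) _
  have hS : MeasurePreserving (sphereMap f)
      (volume : Measure (EuclideanSpace ℂ (Fin d))).toSphere
      (volume : Measure (EuclideanSpace ℂ (Fin d))).toSphere := by
    refine ⟨hc.measurable, Measure.ext fun s hs => ?_⟩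
    rw [Measure.map_apply hc.measurable hs, Measure.toSphere_apply' _ hs,
      Measure.toSphere_apply' _ (hc.measurable hs)]
    congr 1
    have hpre : (Set.Ioo (0 : ℝ) 1 • ((fun u : UnitVec d => u.1) '' (sphereMap f ⁻¹' s)) :
        Set (EuclideanSpace ℂ (Fin d))) =
        f ⁻¹' (Set.Ioo (0 : ℝ) 1 • ((fun u : UnitVec d => u.1) '' s)) := by
      ext v
      simp only [Set.mem_smul, Set.mem_preimage, Set.mem_image]
      constructor
      · rintro ⟨r, hr, _, ⟨u, hu, rfl⟩, rfl⟩
        exact ⟨r, hr, _, ⟨_, hu, rfl⟩, (f.map_smul r u.1).symm⟩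
      · rintro ⟨r, hr, _, ⟨u, hu, rfl⟩, h⟩
        refine ⟨r, hr, _, ⟨⟨f.symm u.1, by simp⟩, ?_, rfl⟩, ?_⟩
        · simpa [sphereMap] using hu
        · apply f.injective
          rw [← h, f.map_smul]
          simp
    rw [hpre]
    exact f.measurePreserving.measure_preimage_equiv (f := f.toMeasurableEquiv) _
  exact hS.smul_measure _

theorem integral_sphereMap {E : Type*} [NormedAddCommGroup E] [NormedSpace ℝ E]
    (f : EuclideanSpace ℂ (Fin d) ≃ₗᵢ[ℝ] EuclideanSpace ℂ (Fin d)) {g : UnitVec d → E}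
    (hg : AEStronglyMeasurable g (haarUnit d)) :
    ∫ u, g (sphereMap f u) ∂(haarUnit d) = ∫ u, g u ∂(haarUnit d) := by
  have h := measurePreserving_sphereMap f
  have h1 := integral_map (μ := haarUnit d) h.1.aemeasurable (f := g) (by rwa [h.2])
  rw [h.2] at h1
  exact h1.symm

/-- A norm preserving complex linear endomorphism as a real linear isometric equivalence. -/
noncomputable def isometryOfNorm (f : EuclideanSpace ℂ (Fin d) →ₗ[ℂ] EuclideanSpace ℂ (Fin d))
    (hf : ∀ v, ‖f v‖ = ‖v‖) : EuclideanSpace ℂ (Fin d) ≃ₗᵢ[ℝ] EuclideanSpace ℂ (Fin d) :=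
  LinearIsometry.toLinearIsometryEquiv ⟨f.restrictScalars ℝ, hf⟩ rfl

theorem isometryOfNorm_apply (f : EuclideanSpace ℂ (Fin d) →ₗ[ℂ] EuclideanSpace ℂ (Fin d))
    (hf : ∀ v, ‖f v‖ = ‖v‖) (v : EuclideanSpace ℂ (Fin d)) : isometryOfNorm f hf v = f v := rfl

/-- Multiplication of one coordinate by a scalar. -/
noncomputable def scaleCoord (t : Fin d) (ω : ℂ) : EuclideanSpace ℂ (Fin d) →ₗ[ℂ] EuclideanSpace ℂ (Fin d) where
  toFun v := WithLp.toLp 2 fun i => (if i = t then ω else 1) * v i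
  map_add' v w := by
    ext i
    simp [mul_add]
  map_smul' r v := by
    ext i
    simp [mul_left_comm]

theorem norm_scaleCoord (t : Fin d) {ω : ℂ} (hω : ‖ω‖ = 1) (v : EuclideanSpace ℂ (Fin d)) :
    ‖scaleCoord t ω v‖ = ‖v‖ := by
  rw [EuclideanSpace.norm_eq, EuclideanSpace.norm_eq]
  congr 1
  refine Finset.sum_congr rfl fun i _ => ?_
  simp only [scaleCoord, LinearMap.coe_mk, AddHom.coe_mk, norm_mul]
  split_ifs <;> simp [hω]

/-- The rotation with matrix `[[α, β], [-conj β, conj α]]` of the coordinates `a` and `b`. -/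
noncomputable def planeRotation (a b : Fin d) (α β : ℂ) :
    EuclideanSpace ℂ (Fin d) →ₗ[ℂ] EuclideanSpace ℂ (Fin d) where
  toFun v := WithLp.toLp 2 fun i =>
    if i = a then α * v a + β * v b else if i = b then -star β * v a + star α * v b else v i
  map_add' v w := by
    ext i
    simp only [PiLp.add_apply]
    split_ifs <;> ring
  map_smul' r v := by
    ext i
    simp only [PiLp.smul_apply, smul_eq_mul, RingHom.id_apply]
    split_ifs <;> ring

theorem sum_eq_add_add_sum_erase {a b : Fin d} (hab : a ≠ b) (g : Fin d → ℝ) :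
    ∑ i, g i = g a + g b + ∑ i ∈ (Finset.univ.erase a).erase b, g i := by
  rw [← Finset.add_sum_erase _ _ (Finset.mem_univ a), ← Finset.add_sum_erase (Finset.univ.erase a) _
    (Finset.mem_erase.2 ⟨hab.symm, Finset.mem_univ b⟩), add_assoc]

theorem norm_planeRotation {a b : Fin d} (hab : a ≠ b) {α β : ℂ}
    (h : ‖α‖ ^ 2 + ‖β‖ ^ 2 = 1) (v : EuclideanSpace ℂ (Fin d)) :
    ‖planeRotation a b α β v‖ = ‖v‖ := by
  rw [EuclideanSpace.norm_eq, EuclideanSpace.norm_eq]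
  congr 1
  rw [sum_eq_add_add_sum_erase hab, sum_eq_add_add_sum_erase hab]
  congr 1
  · simp only [planeRotation, LinearMap.coe_mk, AddHom.coe_mk, if_true, if_neg hab.symm]
    simp only [← Complex.normSq_eq_norm_sq, Complex.normSq_apply] at h ⊢
    simp only [Complex.add_re, Complex.add_im, Complex.mul_re, Complex.mul_im, Complex.neg_re,
      Complex.neg_im, Complex.star_def, Complex.conj_re, Complex.conj_im]
    linear_combination ((v a).re ^ 2 + (v a).im ^ 2 + (v b).re ^ 2 + (v b).im ^ 2) * h
  · refine Finset.sum_congr rfl fun i hi => ?_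
    simp only [Finset.mem_erase] at hi
    simp [planeRotation, hi.1, hi.2.1]

theorem bddMeas_coord (i : Fin d) : BddMeas fun u : UnitVec d => u.1 i := by
  refine ⟨?_, 1, fun u => ?_⟩
  · have : Continuous fun u : UnitVec d => u.1 i := by fun_prop
    exact this.measurable
  · have h := PiLp.norm_apply_le u.1 i
    rwa [norm_eq_of_mem_sphere] at h

theorem sum_norm_sq_coord (u : UnitVec d) : ∑ i, ‖u.1 i‖ ^ 2 = 1 := by
  rw [← EuclideanSpace.norm_sq_eq, norm_eq_of_mem_sphere, one_pow]

/-- The mixed third moments of the coordinates of a uniformly random unit vector. -/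
noncomputable def coordMoment (a b c i j k : Fin d) : ℂ :=
  ∫ u : UnitVec d, u.1 a * u.1 b * u.1 c * (star (u.1 i) * star (u.1 j) * star (u.1 k))
    ∂(haarUnit d)

theorem bddMeas_coordMonomial (a b c i j k : Fin d) : BddMeas fun u : UnitVec d =>
    u.1 a * u.1 b * u.1 c * (star (u.1 i) * star (u.1 j) * star (u.1 k)) :=
  (((bddMeas_coord a).mul (bddMeas_coord b)).mul (bddMeas_coord c)).mul
    (((bddMeas_coord i).star.mul (bddMeas_coord j).star).mul (bddMeas_coord k).star)

/-- Multiplying coordinate `t` by the phase `I` multiplies the moment by `I` to the difference of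
the two counts. This difference is nonzero and at most 3 in absolute value, so a phase of order 4
suffices. -/
theorem coordMoment_eq_zero (t a b c i j k : Fin d)
    (h : (if a = t then 1 else 0) + (if b = t then 1 else 0) + (if c = t then 1 else 0) ≠
      (if i = t then 1 else 0) + (if j = t then 1 else 0) + (if k = t then 1 else 0)) :
    coordMoment a b c i j k = 0 := by
  have h1 := integral_sphereMap (isometryOfNorm (scaleCoord t Complex.I)
    (norm_scaleCoord t Complex.norm_I)) (bddMeas_coordMonomial a b c i j k).1.aestronglyMeasurable
  rw [← coordMoment] at h1
  simp only [sphereMap, isometryOfNorm_apply, scaleCoord, LinearMap.coe_mk, AddHom.coe_mk,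
    star_mul'] at h1
  set γ : ℂ := (if a = t then Complex.I else 1) * (if b = t then Complex.I else 1) *
    (if c = t then Complex.I else 1) * (star (if i = t then Complex.I else 1) *
      star (if j = t then Complex.I else 1) * star (if k = t then Complex.I else 1)) with hγ
  have h2 : γ * coordMoment a b c i j k = coordMoment a b c i j k := by
    rw [← h1]
    conv_lhs => rw [h1, coordMoment, ← integral_const_mul]
    refine integral_congr_ae (Filter.Eventually.of_forall fun u => ?_)
    simp only [hγ]
    ring
  have h3 : γ ≠ 1 := by
    rw [hγ]
    intro h4
    revert h h4
    have hI : Complex.I ≠ 1 := fun h => by simpa using congrArg Complex.re h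
    have hI' : -Complex.I ≠ 1 := fun h => by simpa using congrArg Complex.re h
    split_ifs <;> simp [hI, hI', CharZero.neg_eq_self_iff]
  by_contra h0
  exact h3 (mul_right_cancel₀ h0 (h2.trans (one_mul _).symm))

/-- The moments `E |u_a|² |u_b|² |u_c|²` of a uniformly random unit vector. -/
noncomputable def absMoment (a b c : Fin d) : ℝ :=
  ∫ u : UnitVec d, ‖u.1 a‖ ^ 2 * ‖u.1 b‖ ^ 2 * ‖u.1 c‖ ^ 2 ∂(haarUnit d)

theorem bddMeas_absMonomial (a b c : Fin d) :
    BddMeas fun u : UnitVec d => ‖u.1 a‖ ^ 2 * ‖u.1 b‖ ^ 2 * ‖u.1 c‖ ^ 2 :=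
  ((bddMeas_coord a).norm_sq.mul (bddMeas_coord b).norm_sq).mul (bddMeas_coord c).norm_sq

theorem coordMoment_self (a b c : Fin d) : coordMoment a b c a b c = (absMoment a b c : ℂ) := by
  rw [coordMoment, absMoment, ← integral_complex_ofReal]
  refine integral_congr_ae (Filter.Eventually.of_forall fun u => ?_)
  have h : ∀ z : ℂ, ((‖z‖ ^ 2 : ℝ) : ℂ) = z * star z := fun z => by
    rw [Complex.star_def, Complex.mul_conj, Complex.normSq_eq_norm_sq]
  simp only [Complex.ofReal_mul, h]
  ring

theorem coordMoment_comm_left (a b c i j k : Fin d) :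
    coordMoment a b c i j k = coordMoment b a c i j k := by
  unfold coordMoment
  congr 1
  ext u
  ring

theorem coordMoment_comm_right (a b c i j k : Fin d) :
    coordMoment a b c i j k = coordMoment a c b i j k := by
  unfold coordMoment
  congr 1
  ext u
  ring

theorem absMoment_comm_left (a b c : Fin d) : absMoment a b c = absMoment b a c := by
  unfold absMoment
  congr 1
  ext u
  ring

theorem absMoment_comm_right (a b c : Fin d) : absMoment a b c = absMoment a c b := by
  unfold absMoment
  congr 1
  ext u
  ring

theorem integral_planeRotation {a b : Fin d} (hab : a ≠ b) {α β : ℂ}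
    (h : ‖α‖ ^ 2 + ‖β‖ ^ 2 = 1) (p q r : Fin d) :
    ∫ u : UnitVec d, ‖planeRotation a b α β u.1 p‖ ^ 2 * ‖planeRotation a b α β u.1 q‖ ^ 2 *
      ‖planeRotation a b α β u.1 r‖ ^ 2 ∂(haarUnit d) = absMoment p q r :=
  integral_sphereMap (isometryOfNorm _ (norm_planeRotation hab h))
    (bddMeas_absMonomial p q r).1.aestronglyMeasurable

theorem planeRotation_left (a b : Fin d) (α β : ℂ) (v : EuclideanSpace ℂ (Fin d)) :
    planeRotation a b α β v a = α * v a + β * v b := by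
  simp [planeRotation]

theorem planeRotation_right {a b : Fin d} (hab : a ≠ b) (α β : ℂ)
    (v : EuclideanSpace ℂ (Fin d)) :
    planeRotation a b α β v b = -star β * v a + star α * v b := by
  simp [planeRotation, hab.symm]

theorem planeRotation_of_ne {a b c : Fin d} (ha : c ≠ a) (hb : c ≠ b) (α β : ℂ)
    (v : EuclideanSpace ℂ (Fin d)) : planeRotation a b α β v c = v c := by
  simp [planeRotation, ha, hb]

theorem bddMeas_planeRotation (a b : Fin d) (α β : ℂ) (p : Fin d) :
    BddMeas fun u : UnitVec d => planeRotation a b α β u.1 p := by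
  have hlin : ∀ r s : ℂ, BddMeas fun u : UnitVec d => r * u.1 a + s * u.1 b := fun r s =>
    (BddMeas.mul (E := ℂ) (.const r) (bddMeas_coord a)).add
      (BddMeas.mul (E := ℂ) (.const s) (bddMeas_coord b))
  by_cases hp : p = a
  · rw [hp]
    simp only [planeRotation_left]
    exact hlin _ _
  · by_cases hq : p = b
    · rw [hq]
      simp only [planeRotation_right (fun h => hp (hq.trans h.symm))]
      exact hlin _ _
    · simp only [planeRotation_of_ne hp hq]
      exact bddMeas_coord p

theorem absMoment_swap {a b : Fin d} (hab : a ≠ b) : absMoment a a a = absMoment b b b := by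
  rw [← integral_planeRotation hab (α := 0) (β := 1) (by simp) a a a, absMoment]
  simp [planeRotation_left]

theorem absMoment_swap_two {a b : Fin d} (hab : a ≠ b) : absMoment a a b = absMoment b b a := by
  rw [← integral_planeRotation hab (α := 0) (β := 1) (by simp) a a b, absMoment]
  simp [planeRotation_left, planeRotation_right hab]

/-- Summing over the phases ±1, ±I of the coefficient of `y` kills the unbalanced cross terms,
leaving the squared binomials 1, 9, 9, 1 times powers of 9/25 and 16/25. The pair 3/5, 4/5 makes the
rotation rational. -/
theorem sum_norm_rotation_pow_six (x y : ℂ) :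
    ‖(3 / 5 : ℂ) * x + (4 / 5 : ℂ) * y‖ ^ 2 * ‖(3 / 5 : ℂ) * x + (4 / 5 : ℂ) * y‖ ^ 2 *
        ‖(3 / 5 : ℂ) * x + (4 / 5 : ℂ) * y‖ ^ 2 +
      ‖(3 / 5 : ℂ) * x + (-4 / 5 : ℂ) * y‖ ^ 2 * ‖(3 / 5 : ℂ) * x + (-4 / 5 : ℂ) * y‖ ^ 2 *
        ‖(3 / 5 : ℂ) * x + (-4 / 5 : ℂ) * y‖ ^ 2 +
      (‖(3 / 5 : ℂ) * x + (4 / 5 * Complex.I : ℂ) * y‖ ^ 2 *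
          ‖(3 / 5 : ℂ) * x + (4 / 5 * Complex.I : ℂ) * y‖ ^ 2 *
          ‖(3 / 5 : ℂ) * x + (4 / 5 * Complex.I : ℂ) * y‖ ^ 2 +
        ‖(3 / 5 : ℂ) * x + (-4 / 5 * Complex.I : ℂ) * y‖ ^ 2 *
          ‖(3 / 5 : ℂ) * x + (-4 / 5 * Complex.I : ℂ) * y‖ ^ 2 *
          ‖(3 / 5 : ℂ) * x + (-4 / 5 * Complex.I : ℂ) * y‖ ^ 2) =
    4 / 15625 * (729 * (‖x‖ ^ 2 * ‖x‖ ^ 2 * ‖x‖ ^ 2) + 11664 * (‖x‖ ^ 2 * ‖x‖ ^ 2 * ‖y‖ ^ 2) +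
      (20736 * (‖y‖ ^ 2 * ‖y‖ ^ 2 * ‖x‖ ^ 2) + 4096 * (‖y‖ ^ 2 * ‖y‖ ^ 2 * ‖y‖ ^ 2))) := by
  have h5 : ((3 / 5 : ℂ)).re = 3 / 5 ∧ ((3 / 5 : ℂ)).im = 0 ∧ ((4 / 5 : ℂ)).re = 4 / 5 ∧
      ((4 / 5 : ℂ)).im = 0 ∧ ((-4 / 5 : ℂ)).re = -4 / 5 ∧ ((-4 / 5 : ℂ)).im = 0 := by
    norm_num [Complex.div_re, Complex.div_im, Complex.normSq_apply]
  simp only [← Complex.normSq_eq_norm_sq, Complex.normSq_apply, Complex.add_re, Complex.add_im,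
    Complex.mul_re, Complex.mul_im, Complex.I_re, Complex.I_im, h5]
  ring

theorem sum_norm_rotation_pow_four (x y : ℂ) :
    ‖(3 / 5 : ℂ) * x + (4 / 5 : ℂ) * y‖ ^ 2 * ‖(3 / 5 : ℂ) * x + (4 / 5 : ℂ) * y‖ ^ 2 +
      ‖(3 / 5 : ℂ) * x + (-4 / 5 : ℂ) * y‖ ^ 2 * ‖(3 / 5 : ℂ) * x + (-4 / 5 : ℂ) * y‖ ^ 2 +
      (‖(3 / 5 : ℂ) * x + (4 / 5 * Complex.I : ℂ) * y‖ ^ 2 *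
          ‖(3 / 5 : ℂ) * x + (4 / 5 * Complex.I : ℂ) * y‖ ^ 2 +
        ‖(3 / 5 : ℂ) * x + (-4 / 5 * Complex.I : ℂ) * y‖ ^ 2 *
          ‖(3 / 5 : ℂ) * x + (-4 / 5 * Complex.I : ℂ) * y‖ ^ 2) =
    4 / 625 * (81 * (‖x‖ ^ 2 * ‖x‖ ^ 2) + 576 * (‖x‖ ^ 2 * ‖y‖ ^ 2) +
      256 * (‖y‖ ^ 2 * ‖y‖ ^ 2)) := by
  have h5 : ((3 / 5 : ℂ)).re = 3 / 5 ∧ ((3 / 5 : ℂ)).im = 0 ∧ ((4 / 5 : ℂ)).re = 4 / 5 ∧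
      ((4 / 5 : ℂ)).im = 0 ∧ ((-4 / 5 : ℂ)).re = -4 / 5 ∧ ((-4 / 5 : ℂ)).im = 0 := by
    norm_num [Complex.div_re, Complex.div_im, Complex.normSq_apply]
  simp only [← Complex.normSq_eq_norm_sq, Complex.normSq_apply, Complex.add_re, Complex.add_im,
    Complex.mul_re, Complex.mul_im, Complex.I_re, Complex.I_im, h5]
  ring

theorem BddMeas.integral_add {α E : Type*} [MeasurableSpace α] [NormedRing E] [NormedSpace ℝ E]
    [MeasurableSpace E] [BorelSpace E] [SecondCountableTopology E] {f g : α → E}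
    (hf : BddMeas f) (hg : BddMeas g) (μ : Measure α) [IsFiniteMeasure μ] :
    ∫ x, f x + g x ∂μ = ∫ x, f x ∂μ + ∫ x, g x ∂μ :=
  MeasureTheory.integral_add (hf.integrable μ) (hg.integrable μ)

theorem sum_integral_rotations [NeZero d] {a b : Fin d} (hab : a ≠ b) (p q r : Fin d) :
    ∫ u : UnitVec d, (‖planeRotation a b (3 / 5) (4 / 5) u.1 p‖ ^ 2 *
          ‖planeRotation a b (3 / 5) (4 / 5) u.1 q‖ ^ 2 *
          ‖planeRotation a b (3 / 5) (4 / 5) u.1 r‖ ^ 2 +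
        ‖planeRotation a b (3 / 5) (-4 / 5) u.1 p‖ ^ 2 *
          ‖planeRotation a b (3 / 5) (-4 / 5) u.1 q‖ ^ 2 *
          ‖planeRotation a b (3 / 5) (-4 / 5) u.1 r‖ ^ 2 +
        (‖planeRotation a b (3 / 5) (4 / 5 * Complex.I) u.1 p‖ ^ 2 *
          ‖planeRotation a b (3 / 5) (4 / 5 * Complex.I) u.1 q‖ ^ 2 *
          ‖planeRotation a b (3 / 5) (4 / 5 * Complex.I) u.1 r‖ ^ 2 +
        ‖planeRotation a b (3 / 5) (-4 / 5 * Complex.I) u.1 p‖ ^ 2 *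
          ‖planeRotation a b (3 / 5) (-4 / 5 * Complex.I) u.1 q‖ ^ 2 *
          ‖planeRotation a b (3 / 5) (-4 / 5 * Complex.I) u.1 r‖ ^ 2)) ∂(haarUnit d) =
      4 * absMoment p q r := by
  have hI : ∀ α β : ℂ, BddMeas (fun u : UnitVec d =>
      ‖planeRotation a b α β u.1 p‖ ^ 2 * ‖planeRotation a b α β u.1 q‖ ^ 2 *
        ‖planeRotation a b α β u.1 r‖ ^ 2) := fun _ _ =>
    ((bddMeas_planeRotation a b _ _ p).norm_sq.mul (bddMeas_planeRotation a b _ _ q).norm_sq).mul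
      (bddMeas_planeRotation a b _ _ r).norm_sq
  have h1 : ‖(3 / 5 : ℂ)‖ ^ 2 + ‖(4 / 5 : ℂ)‖ ^ 2 = 1 := by norm_num
  have h2 : ‖(3 / 5 : ℂ)‖ ^ 2 + ‖(-4 / 5 : ℂ)‖ ^ 2 = 1 := by norm_num
  have h3 : ‖(3 / 5 : ℂ)‖ ^ 2 + ‖(4 / 5 * Complex.I : ℂ)‖ ^ 2 = 1 := by norm_num
  have h4 : ‖(3 / 5 : ℂ)‖ ^ 2 + ‖(-4 / 5 * Complex.I : ℂ)‖ ^ 2 = 1 := by norm_num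
  rw [((hI _ _).add (hI _ _)).integral_add ((hI _ _).add (hI _ _)), (hI _ _).integral_add (hI _ _),
    (hI _ _).integral_add (hI _ _), integral_planeRotation hab h1, integral_planeRotation hab h2,
    integral_planeRotation hab h3, integral_planeRotation hab h4]
  ring

/-- Invariance under the four rotations, with the symmetry of `a` and `b`, reads (15625 - 729 -
4096) E|u_a|⁶ = (11664 + 20736) E|u_a|⁴|u_b|². -/
theorem absMoment_two_one [NeZero d] {a b : Fin d} (hab : a ≠ b) :
    absMoment a a a = 3 * absMoment a a b := by
  have h := sum_integral_rotations hab a a a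
  simp only [planeRotation_left, sum_norm_rotation_pow_six] at h
  have hI := fun (t : ℝ) (p q r : Fin d) => (BddMeas.const t).mul (bddMeas_absMonomial p q r)
  rw [integral_const_mul, ((hI _ a a a).add (hI _ a a b)).integral_add
    ((hI _ b b a).add (hI _ b b b)),
    (hI _ a a a).integral_add (hI _ a a b),
    (hI _ b b a).integral_add (hI _ b b b), integral_const_mul,
    integral_const_mul, integral_const_mul, integral_const_mul] at h
  simp only [← absMoment.eq_def] at h
  rw [← absMoment_swap hab, ← absMoment_swap_two hab] at h
  linarith

/-- The same averaging with a spectator coordinate `c` gives E|u_a|⁴|u_c|² = 2 E|u_a|²|u_b|²|u_c|²;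
`absMoment_two_one` supplies the other factor 3. -/
theorem absMoment_distinct [NeZero d] {a b c : Fin d} (hab : a ≠ b) (hac : c ≠ a)
    (hbc : c ≠ b) : absMoment a a a = 6 * absMoment a b c := by
  have h := sum_integral_rotations hab a a c
  simp only [planeRotation_left, planeRotation_of_ne hac hbc, ← add_mul,
    sum_norm_rotation_pow_four] at h
  have hI := fun (t : ℝ) (p q r : Fin d) => (BddMeas.const t).mul (bddMeas_absMonomial p q r)
  have e : ∀ u : UnitVec d, 4 / 625 * (81 * (‖u.1 a‖ ^ 2 * ‖u.1 a‖ ^ 2) +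
      576 * (‖u.1 a‖ ^ 2 * ‖u.1 b‖ ^ 2) + 256 * (‖u.1 b‖ ^ 2 * ‖u.1 b‖ ^ 2)) * ‖u.1 c‖ ^ 2 =
      4 / 625 * (81 * (‖u.1 a‖ ^ 2 * ‖u.1 a‖ ^ 2 * ‖u.1 c‖ ^ 2) +
      576 * (‖u.1 a‖ ^ 2 * ‖u.1 b‖ ^ 2 * ‖u.1 c‖ ^ 2) +
      256 * (‖u.1 b‖ ^ 2 * ‖u.1 b‖ ^ 2 * ‖u.1 c‖ ^ 2)) := fun u => by ring
  simp only [e] at h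
  rw [integral_const_mul, ((hI _ a a c).add (hI _ a b c)).integral_add
    (hI _ b b c), (hI _ a a c).integral_add (hI _ a b c),
    integral_const_mul, integral_const_mul, integral_const_mul] at h
  simp only [← absMoment.eq_def] at h
  have h1 := absMoment_two_one hac.symm
  have h2 := absMoment_two_one hbc.symm
  rw [← absMoment_swap hab] at h2
  linarith

/-- The bracket counts the permutations fixing the triple `(a, b, c)`: 1, 2 or 6. -/
theorem absMoment_eq [NeZero d] (a b c : Fin d) :
    absMoment a b c = absMoment (0 : Fin d) 0 0 / 6 * (1 + (if a = b then 1 else 0) +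
      (if b = c then 1 else 0) + (if a = c then 1 else 0) +
      2 * (if a = b ∧ b = c then 1 else 0)) := by
  have h0 : absMoment (0 : Fin d) 0 0 = absMoment a a a := by
    by_cases h : 0 = a
    · rw [← h]
    · exact absMoment_swap h
  rw [h0]
  by_cases hab : a = b
  · subst hab
    by_cases hac : a = c
    · subst hac
      simp
      ring
    · simp [hac, absMoment_two_one hac]
      ring
  · by_cases hac : a = c
    · subst hac
      rw [absMoment_comm_right, absMoment_two_one hab]
      simp [hab, Ne.symm hab]
      ring
    · by_cases hbc : b = c
      · subst hbc
        rw [absMoment_comm_left, absMoment_comm_right, absMoment_swap hab,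
          absMoment_two_one (Ne.symm hab)]
        simp [hab]
        ring
      · simp [hab, hac, hbc, absMoment_distinct hab (Ne.symm hac) (Ne.symm hbc)]

theorem sum_absMoment [NeZero d] : ∑ a : Fin d, ∑ b : Fin d, ∑ c : Fin d, absMoment a b c = 1 := by
  have hI := fun p q r : Fin d => (bddMeas_absMonomial p q r).integrable (haarUnit d)
  unfold absMoment
  simp only [← integral_finsetSum _ fun c _ => hI _ _ c]
  simp only [← Finset.mul_sum, sum_norm_sq_coord, mul_one]
  have hI2 := fun p q : Fin d => ((bddMeas_coord p).norm_sq.mul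
    (bddMeas_coord q).norm_sq).integrable (haarUnit d)
  simp only [← integral_finsetSum _ fun c _ => hI2 _ c]
  simp only [← Finset.mul_sum, sum_norm_sq_coord, mul_one]
  rw [← integral_finsetSum _ fun c _ => (bddMeas_coord c).norm_sq.integrable (haarUnit d)]
  simp [sum_norm_sq_coord]

/-- Normalization: all the moments sum to 1, and the brackets of `absMoment_eq` sum to d³ + 3d² +
2d. -/
theorem absMoment_zero [NeZero d] :
    absMoment (0 : Fin d) 0 0 / 6 = 1 / ((d : ℝ) * (d + 1) * (d + 2)) := by
  have h := sum_absMoment (d := d)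
  have he := fun a b c : Fin d => absMoment_eq a b c
  generalize absMoment (0 : Fin d) 0 0 / 6 = e at he ⊢
  simp only [he, ← Finset.mul_sum, Finset.sum_add_distrib,
    ite_and, Finset.sum_const, Finset.card_univ, Fintype.card_fin, Finset.sum_ite_eq,
    Finset.mem_univ, if_true, nsmul_eq_mul, mul_one, Finset.sum_ite_irrel,
    mul_zero] at h
  have hd : (0 : ℝ) < d := by exact_mod_cast Nat.pos_of_ne_zero (NeZero.ne d)
  field_simp
  linarith

/-- The number of permutations that match the indices `a b c` with `i j k`. -/
def matchings (a b c i j k : Fin d) : ℂ :=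
  (if a = i then 1 else 0) * (if b = j then 1 else 0) * (if c = k then 1 else 0) +
    (if a = i then 1 else 0) * (if b = k then 1 else 0) * (if c = j then 1 else 0) +
    (if a = j then 1 else 0) * (if b = i then 1 else 0) * (if c = k then 1 else 0) +
    (if a = j then 1 else 0) * (if b = k then 1 else 0) * (if c = i then 1 else 0) +
    (if a = k then 1 else 0) * (if b = i then 1 else 0) * (if c = j then 1 else 0) +
    (if a = k then 1 else 0) * (if b = j then 1 else 0) * (if c = i then 1 else 0)

theorem matchings_comm_left (a b c i j k : Fin d) :
    matchings a b c i j k = matchings b a c i j k := by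
  unfold matchings
  ring

theorem matchings_comm_right (a b c i j k : Fin d) :
    matchings a b c i j k = matchings a c b i j k := by
  unfold matchings
  ring

/-- Lower indices are matched with upper ones one at a time, permuting the upper ones as needed. If
some index finds no partner, its two counts differ and both sides vanish; otherwise an absolute
moment remains. -/
theorem coordMoment_eq [NeZero d] (a b c i j k : Fin d) :
    coordMoment a b c i j k = 1 / ((d : ℂ) * (d + 1) * (d + 2)) * matchings a b c i j k := by
  have two : ∀ a b c k : Fin d, coordMoment a b c a b k =
      1 / ((d : ℂ) * (d + 1) * (d + 2)) * matchings a b c a b k := fun a b c k => by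
    by_cases hk : c = k
    · subst hk
      rw [coordMoment_self, absMoment_eq, absMoment_zero]
      push_cast
      congr 1
      unfold matchings
      by_cases hab : a = b
      · subst hab
        by_cases hac : a = c
        · subst hac
          norm_num
        · norm_num [hac, Ne.symm hac]
      · by_cases hac : a = c
        · subst hac
          norm_num [hab, Ne.symm hab]
        · by_cases hbc : b = c
          · subst hbc
            norm_num [hab, Ne.symm hab]
          · norm_num [hab, Ne.symm hab, hac, Ne.symm hac, hbc, Ne.symm hbc]
    · rw [coordMoment_eq_zero k _ _ _ _ _ _ (by simp [hk])]
      symm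
      refine mul_eq_zero_of_right _ ?_
      unfold matchings
      by_cases h1 : b = k
      · subst h1
        simp [hk]
        grind
      · by_cases h2 : a = k
        · subst h2
          simp [hk]
          exact fun _ => h1
        · simp [hk, h1, h2]
  have one : ∀ a b c j k : Fin d, coordMoment a b c a j k =
      1 / ((d : ℂ) * (d + 1) * (d + 2)) * matchings a b c a j k := fun a b c j k => by
    by_cases hb : b = j
    · subst hb
      exact two a b c k
    · by_cases hc : c = j
      · subst hc
        rw [coordMoment_comm_right, matchings_comm_right]
        exact two a c b k
      · rw [coordMoment_eq_zero j _ _ _ _ _ _ (by simp [hb, hc]; split_ifs <;> simp)]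
        symm
        refine mul_eq_zero_of_right _ ?_
        unfold matchings
        by_cases h2 : a = j
        · subst h2
          simp [hb, hc]
        · simp [hb, hc, h2]
  by_cases ha : a = i
  · subst ha
    exact one a b c j k
  · by_cases hb : b = i
    · subst hb
      rw [coordMoment_comm_left, matchings_comm_left]
      exact one b a c j k
    · by_cases hc : c = i
      · subst hc
        rw [coordMoment_comm_right, coordMoment_comm_left, matchings_comm_right,
          matchings_comm_left]
        exact one c a b j k
      · rw [coordMoment_eq_zero i _ _ _ _ _ _ (by simp [ha, hb, hc]; split_ifs <;> simp)]
        simp [matchings, ha, hb, hc]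

/-- The third moments of the uniform measure on unit vectors. -/
theorem integral_braket_mul_braket_mul_braket [NeZero d] (A B C : Matrix (Fin d) (Fin d) ℂ) :
    ∫ u, braket A u * braket B u * braket C u ∂(haarUnit d) =
      1 / ((d : ℂ) * (d + 1) * (d + 2)) * (A.trace * B.trace * C.trace +
        A.trace * (B * C).trace + (A * B).trace * C.trace + (A * B * C).trace +
        (A * C * B).trace + (A * C).trace * B.trace) := by
  have hexp : ∀ u : UnitVec d, braket A u * braket B u * braket C u =
      ∑ i, ∑ j, ∑ k, ∑ a, ∑ b, ∑ c, A i a * B j b * C k c *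
        (u.1 a * u.1 b * u.1 c * (star (u.1 i) * star (u.1 j) * star (u.1 k))) := fun u => by
    simp only [braket]
    rw [Finset.sum_mul_sum, Finset.sum_mul]
    refine Finset.sum_congr rfl fun i _ => ?_
    rw [Finset.sum_mul_sum]
    refine Finset.sum_congr rfl fun j _ => Finset.sum_congr rfl fun k _ => ?_
    rw [Finset.sum_mul_sum, Finset.sum_mul]
    refine Finset.sum_congr rfl fun a _ => ?_
    rw [Finset.sum_mul_sum]
    refine Finset.sum_congr rfl fun b _ => Finset.sum_congr rfl fun c _ => ?_
    ring
  have hI : ∀ i j k a b c, BddMeas fun u : UnitVec d => A i a * B j b * C k c *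
      (u.1 a * u.1 b * u.1 c * (star (u.1 i) * star (u.1 j) * star (u.1 k))) :=
    fun i j k a b c => (BddMeas.const _).mul (bddMeas_coordMonomial a b c i j k)
  have h1 : ∫ u, braket A u * braket B u * braket C u ∂(haarUnit d) =
      ∑ i, ∑ j, ∑ k, ∑ a, ∑ b, ∑ c, A i a * B j b * C k c * coordMoment a b c i j k := by
    simp only [hexp]
    rw [integral_finsetSum _ fun i _ => (BddMeas.sum fun j _ => BddMeas.sum fun k _ =>
      BddMeas.sum fun a _ => BddMeas.sum fun b _ => BddMeas.sum fun c _ =>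
        hI i j k a b c).integrable _]
    refine Finset.sum_congr rfl fun i _ => ?_
    rw [integral_finsetSum _ fun j _ => (BddMeas.sum fun k _ =>
      BddMeas.sum fun a _ => BddMeas.sum fun b _ => BddMeas.sum fun c _ =>
        hI i j k a b c).integrable _]
    refine Finset.sum_congr rfl fun j _ => ?_
    rw [integral_finsetSum _ fun k _ => (BddMeas.sum fun a _ => BddMeas.sum fun b _ =>
      BddMeas.sum fun c _ => hI i j k a b c).integrable _]
    refine Finset.sum_congr rfl fun k _ => ?_
    rw [integral_finsetSum _ fun a _ => (BddMeas.sum fun b _ =>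
      BddMeas.sum fun c _ => hI i j k a b c).integrable _]
    refine Finset.sum_congr rfl fun a _ => ?_
    rw [integral_finsetSum _ fun b _ => (BddMeas.sum fun c _ => hI i j k a b c).integrable _]
    refine Finset.sum_congr rfl fun b _ => ?_
    rw [integral_finsetSum _ fun c _ => (hI i j k a b c).integrable _]
    refine Finset.sum_congr rfl fun c _ => ?_
    rw [integral_const_mul, coordMoment]
  rw [h1]
  have h2 : ∀ i j k a b c : Fin d, A i a * B j b * C k c * coordMoment a b c i j k =
      1 / ((d : ℂ) * (d + 1) * (d + 2)) * (A i a * B j b * C k c * matchings a b c i j k) :=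
    fun i j k a b c => by
      rw [coordMoment_eq]
      ring
  simp only [h2, ← Finset.mul_sum]
  congr 1
  -- Each permutation contributes the product of traces given by its cycles.
  simp only [matchings, mul_add, Finset.sum_add_distrib, mul_ite, mul_one, mul_zero,
    Finset.sum_ite_eq', Finset.mem_univ, if_true]
  simp only [Matrix.trace, Matrix.diag_apply, Matrix.mul_apply]
  refine congrArg₂ (· + ·) (congrArg₂ (· + ·) (congrArg₂ (· + ·) (congrArg₂ (· + ·)
    (congrArg₂ (· + ·) ?_ ?_) ?_) ?_) ?_) ?_
  · rw [Finset.sum_mul_sum, Finset.sum_mul]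
    exact Finset.sum_congr rfl fun x _ => (Finset.sum_mul_sum _ _ _ _).symm
  · rw [Finset.sum_mul]
    simp only [Finset.mul_sum, mul_assoc]
  · rw [Finset.sum_mul]
    exact Finset.sum_congr rfl fun x _ => (Finset.sum_mul_sum _ _ _ _).symm
  · refine Finset.sum_congr rfl fun x _ => ?_
    rw [Finset.sum_comm]
    simp only [Finset.sum_mul]
  · simp only [Finset.sum_mul, mul_right_comm]
  · rw [Finset.sum_mul]
    refine Finset.sum_congr rfl fun x _ => ?_
    rw [Finset.sum_comm, Finset.sum_mul_sum]
    simp only [mul_right_comm]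

end Haar

/-! ### The conditioned measurement as a measure -/

section Conditioned

variable {d : ℕ}

theorem braket_eq_dotProduct (M : Matrix (Fin d) (Fin d) ℂ) (u : UnitVec d) :
    braket M u = dotProduct (star fun i => u.1 i) (M.mulVec fun i => u.1 i) := by
  simp only [braket, dotProduct, Matrix.mulVec, Finset.mul_sum, Pi.star_apply, mul_assoc]

theorem braket_nonneg {M : Matrix (Fin d) (Fin d) ℂ} (hM : M.PosSemidef) (u : UnitVec d) :
    0 ≤ braket M u := by
  rw [braket_eq_dotProduct]
  exact hM.dotProduct_mulVec_nonneg _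

theorem braket_eq_re {M : Matrix (Fin d) (Fin d) ℂ} (hM : M.PosSemidef) (u : UnitVec d) :
    ((braket M u).re : ℂ) = braket M u :=
  (Complex.eq_re_of_ofReal_le (r := 0) (by simpa using braket_nonneg hM u)).symm

theorem braket_add (A B : Matrix (Fin d) (Fin d) ℂ) (u : UnitVec d) :
    braket (A + B) u = braket A u + braket B u := by
  simp only [braket_eq_dotProduct, Matrix.add_mulVec, dotProduct_add]

theorem braket_smul (r : ℂ) (A : Matrix (Fin d) (Fin d) ℂ) (u : UnitVec d) :
    braket (r • A) u = r * braket A u := by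
  simp only [braket_eq_dotProduct, Matrix.smul_mulVec, dotProduct_smul, smul_eq_mul]

theorem braket_one (u : UnitVec d) : braket 1 u = 1 := by
  rw [braket_eq_dotProduct, Matrix.one_mulVec, dotProduct]
  have h := sum_norm_sq_coord u
  have h2 : ((∑ i, ‖u.1 i‖ ^ 2 : ℝ) : ℂ) = 1 := by rw [h, Complex.ofReal_one]
  rw [← h2, Complex.ofReal_sum]
  refine Finset.sum_congr rfl fun i _ => ?_
  rw [Pi.star_apply, Complex.star_def, mul_comm, Complex.mul_conj, Complex.normSq_eq_norm_sq]

theorem bddMeas_braket (M : Matrix (Fin d) (Fin d) ℂ) : BddMeas fun u => braket M u :=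
  BddMeas.sum fun i _ => BddMeas.sum fun j _ =>
    ((bddMeas_coord i).star.mul (BddMeas.const (M i j))).mul (bddMeas_coord j)

theorem trace_mul_ketbra (A : Matrix (Fin d) (Fin d) ℂ) (u : UnitVec d) :
    (A * ketbra u).trace = braket A u := by
  simp only [Matrix.trace, Matrix.diag_apply, Matrix.mul_apply, ketbra, Matrix.of_apply, braket]
  refine Finset.sum_congr rfl fun i _ => Finset.sum_congr rfl fun j _ => ?_
  ring

theorem ketbra_mul_mul_ketbra (D : Matrix (Fin d) (Fin d) ℂ) (u : UnitVec d) :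
    ketbra u * D * ketbra u = braket D u • ketbra u := by
  ext p q
  simp only [Matrix.mul_apply, ketbra, Matrix.of_apply, braket, Matrix.smul_apply, smul_eq_mul,
    Finset.sum_mul]
  rw [Finset.sum_comm]
  refine Finset.sum_congr rfl fun i _ => Finset.sum_congr rfl fun j _ => ?_
  ring

variable {σ : Matrix (Fin d) (Fin d) ℂ}

theorem isHermitian_singleEstimator (x : Outcome d) : (singleEstimator x).IsHermitian := by
  cases x with
  | inl _ => exact Matrix.isHermitian_zero
  | inr u =>
    have hk : (ketbra u).IsHermitian := by
      ext p q
      simp [ketbra, mul_comm]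
    have hd : star ((d : ℂ) + 1) = (d : ℂ) + 1 := by simp
    simp only [singleEstimator]
    refine Matrix.IsHermitian.sub ?_ Matrix.isHermitian_one
    rw [Matrix.IsHermitian, Matrix.conjTranspose_smul, hk.eq, hd]

theorem matBddMeas_singleEstimator : MatBddMeas (singleEstimator (d := d)) := by
  intro p q
  have h : BddMeas fun u : UnitVec d => ((d : ℂ) + 1) * (u.1 p * star (u.1 q)) +
      -(1 : Matrix (Fin d) (Fin d) ℂ) p q :=
    (BddMeas.mul (E := ℂ) (.const _) ((bddMeas_coord p).mul (bddMeas_coord q).star)).add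
      (BddMeas.const _)
  have heq : ∀ u : UnitVec d, singleEstimator (Sum.inr u) p q =
      ((d : ℂ) + 1) * (u.1 p * star (u.1 q)) + -(1 : Matrix (Fin d) (Fin d) ℂ) p q := fun u => by
    simp [singleEstimator, ketbra, sub_eq_add_neg]
  obtain ⟨C, hC⟩ := h.2
  have hm : Measurable fun u : UnitVec d => singleEstimator (Sum.inr u) p q := by
    simpa only [heq] using h.1
  refine ⟨measurable_fun_sum measurable_const hm, max C 0, ?_⟩
  · rintro (x | u)
    · simp [singleEstimator]
    · exact (congrArg norm (heq u)).trans_le ((hC u).trans (le_max_left _ _))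

theorem isFiniteMeasure_uniformPOVM [NeZero d] : IsFiniteMeasure (uniformPOVM σ) := by
  have h : BddMeas fun u : UnitVec d => (d : ℝ) * (braket σ u).re :=
    (BddMeas.const _).mul (bddMeas_braket σ).re
  exact isFiniteMeasure_withDensity_ofReal (h.integrable (haarUnit d)).2

theorem integral_uniformPOVM [NeZero d] (hσ : σ.PosSemidef) (g : UnitVec d → ℂ) :
    ∫ u, g u ∂(uniformPOVM σ) = ∫ u, (d : ℂ) * braket σ u * g u ∂(haarUnit d) := by
  have h : BddMeas fun u : UnitVec d => (d : ℝ) * (braket σ u).re :=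
    (BddMeas.const _).mul (bddMeas_braket σ).re
  rw [uniformPOVM, integral_withDensity_eq_integral_toReal_smul h.1.ennreal_ofReal
    (Filter.Eventually.of_forall fun u => ENNReal.ofReal_lt_top)]
  refine integral_congr_ae (Filter.Eventually.of_forall fun u => ?_)
  have h0 : 0 ≤ (d : ℝ) * (braket σ u).re :=
    mul_nonneg (Nat.cast_nonneg d) (Complex.le_def.1 (braket_nonneg hσ u)).1
  simp only [ENNReal.toReal_ofReal h0, Complex.real_smul, Complex.ofReal_mul, braket_eq_re hσ,
    Complex.ofReal_natCast]

theorem integral_braket_mul_braket [NeZero d] (A B : Matrix (Fin d) (Fin d) ℂ) :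
    ∫ u, braket A u * braket B u ∂(haarUnit d) =
      1 / ((d : ℂ) * (d + 1)) * (A.trace * B.trace + (A * B).trace) := by
  have h := integral_braket_mul_braket_mul_braket A B 1
  simp only [braket_one, mul_one, Matrix.trace_one, Fintype.card_fin] at h
  rw [h]
  have hd : (d : ℂ) ≠ 0 := Nat.cast_ne_zero.2 (NeZero.ne d)
  have hd1 : (d : ℂ) + 1 ≠ 0 := by exact_mod_cast Nat.succ_ne_zero d
  have hd2 : (d : ℂ) + 2 ≠ 0 := by exact_mod_cast Nat.succ_ne_zero (d + 1)
  field_simp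
  ring

theorem integral_braket [NeZero d] (A : Matrix (Fin d) (Fin d) ℂ) :
    ∫ u, braket A u ∂(haarUnit d) = 1 / (d : ℂ) * A.trace := by
  have h := integral_braket_mul_braket A 1
  simp only [braket_one, mul_one, Matrix.trace_one, Fintype.card_fin] at h
  rw [h]
  have hd : (d : ℂ) ≠ 0 := Nat.cast_ne_zero.2 (NeZero.ne d)
  have hd1 : (d : ℂ) + 1 ≠ 0 := by exact_mod_cast Nat.succ_ne_zero d
  field_simp

theorem uniformPOVM_univ [NeZero d] (hσ : σ.PosSemidef) :
    uniformPOVM σ Set.univ = ENNReal.ofReal σ.trace.re := by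
  have := isFiniteMeasure_uniformPOVM (σ := σ)
  have h := integral_uniformPOVM hσ fun _ => 1
  have hd : (d : ℂ) ≠ 0 := Nat.cast_ne_zero.2 (NeZero.ne d)
  simp only [integral_const, mul_one] at h
  rw [integral_const_mul, integral_braket, ← mul_assoc, mul_one_div_cancel hd, one_mul] at h
  have h2 : (uniformPOVM σ).real Set.univ = σ.trace.re := by
    rw [← h]
    simp
  rw [← h2, ofReal_measureReal]

/-- The probability of the outcome cancels the normalization of the collapsed state, so only the
subnormalized σ matters. If tr σ = 0 then σ = 0 and both sides vanish. -/
theorem smul_uniformPOVM [NeZero d] (hσ : σ.PosSemidef) :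
    ENNReal.ofReal σ.trace.re • uniformPOVM (σ.trace⁻¹ • σ) = uniformPOVM σ := by
  have hre : σ.trace = (σ.trace.re : ℂ) := by
    simpa using trace_pow_eq_re hσ 1
  have hnn : 0 ≤ σ.trace.re := (Complex.le_def.1 hσ.trace_nonneg).1
  by_cases h0 : σ.trace = 0
  · have hz : σ = 0 := hσ.trace_eq_zero_iff.1 h0
    subst hz
    simp [uniformPOVM, braket]
  · have hne : σ.trace.re ≠ 0 := fun h => h0 (by rw [hre, h, Complex.ofReal_zero])
    rw [uniformPOVM, uniformPOVM, ← withDensity_smul']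
    · congr 1
      ext u
      rw [Pi.smul_apply, smul_eq_mul, ← ENNReal.ofReal_mul hnn, braket_smul, hre,
        ← Complex.ofReal_inv, Complex.re_ofReal_mul, Complex.ofReal_re]
      congr 1
      field_simp
    · exact ENNReal.ofReal_ne_top

variable {Q ρ : Matrix (Fin d) (Fin d) ℂ}

theorem posSemidef_subState (hρ : IsDensityMatrix ρ) (hQ : IsStarProjection Q) :
    (subState Q ρ).PosSemidef := by
  have h := hρ.posSemidef.mul_mul_conjTranspose_same (1 - Q)
  have hQ' : (1 - Q).conjTranspose = 1 - Q := hQ.one_sub.isSelfAdjoint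
  rwa [hQ'] at h

theorem trace_subState (hQ : IsStarProjection Q) :
    (subState Q ρ).trace = ((1 - Q) * ρ).trace := by
  rw [subState, Matrix.trace_mul_comm, ← mul_assoc, hQ.one_sub.isIdempotentElem.eq]

theorem re_trace_mul_add_re_trace_subState (hρ : IsDensityMatrix ρ) (hQ : IsStarProjection Q) :
    (Q * ρ).trace.re + (subState Q ρ).trace.re = 1 := by
  rw [trace_subState hQ, sub_mul, one_mul, Matrix.trace_sub, hρ.trace_eq_one]
  simp

theorem re_trace_mul_nonneg (hρ : IsDensityMatrix ρ) (hQ : IsStarProjection Q) :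
    0 ≤ (Q * ρ).trace.re := by
  have hQp : Q.PosSemidef := by
    have h := Matrix.posSemidef_conjTranspose_mul_self Q
    have hQ' : Q.conjTranspose = Q := hQ.isSelfAdjoint
    rwa [hQ', hQ.isIdempotentElem.eq] at h
  exact (Complex.le_def.1 (trace_mul_posSemidef_nonneg hQp hρ.posSemidef)).1

theorem conditionedPOVM_eq [NeZero d] (hρ : IsDensityMatrix ρ) (hQ : IsStarProjection Q) :
    conditionedPOVM Q ρ = ENNReal.ofReal (Q * ρ).trace.re • Measure.dirac (Sum.inl ()) +
      (uniformPOVM (subState Q ρ)).map Sum.inr := by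
  rw [conditionedPOVM, ← trace_subState hQ, ← Measure.map_smul,
    smul_uniformPOVM (posSemidef_subState hρ hQ)]

theorem isProbabilityMeasure_conditionedPOVM [NeZero d] (hρ : IsDensityMatrix ρ)
    (hQ : IsStarProjection Q) : IsProbabilityMeasure (conditionedPOVM Q ρ) := by
  refine ⟨?_⟩
  rw [conditionedPOVM_eq hρ hQ, Measure.add_apply, Measure.smul_apply, measure_univ, smul_eq_mul,
    mul_one, Measure.map_apply measurable_inr MeasurableSet.univ, Set.preimage_univ,
    uniformPOVM_univ (posSemidef_subState hρ hQ), ← ENNReal.ofReal_add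
      (re_trace_mul_nonneg hρ hQ)
      (Complex.le_def.1 (posSemidef_subState hρ hQ).trace_nonneg).1,
    re_trace_mul_add_re_trace_subState hρ hQ, ENNReal.ofReal_one]

theorem integral_conditionedPOVM [NeZero d] (hρ : IsDensityMatrix ρ) (hQ : IsStarProjection Q)
    {g : Outcome d → ℂ} (hg : BddMeas g) (h0 : g (Sum.inl ()) = 0) :
    ∫ x, g x ∂(conditionedPOVM Q ρ) =
      ∫ u, (d : ℂ) * braket (subState Q ρ) u * g (Sum.inr u) ∂(haarUnit d) := by
  have := isFiniteMeasure_uniformPOVM (σ := subState Q ρ)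
  have : IsFiniteMeasure (ENNReal.ofReal (Q * ρ).trace.re •
      (Measure.dirac (Sum.inl ()) : Measure (Outcome d))) :=
    Measure.smul_finite _ ENNReal.ofReal_ne_top
  rw [conditionedPOVM_eq hρ hQ, integral_add_measure (hg.integrable _) (hg.integrable _),
    integral_smul_measure, integral_dirac' _ _ hg.1.stronglyMeasurable, h0, smul_zero, zero_add,
    integral_map measurable_inr.aemeasurable hg.1.aestronglyMeasurable,
    integral_uniformPOVM (posSemidef_subState hρ hQ)]

end Conditioned

/-! ### First and second moments of the single-copy estimator -/

section SingleCopy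

variable {d : ℕ} {Q ρ : Matrix (Fin d) (Fin d) ℂ}

/-- The observable `A` shifted and rescaled so that its quadratic form is
`tr (A ((d + 1) |u⟩⟨u| - 1))`. -/
def dualObservable (A : Matrix (Fin d) (Fin d) ℂ) : Matrix (Fin d) (Fin d) ℂ :=
  ((d : ℂ) + 1) • A + (-A.trace) • 1

theorem trace_mul_singleEstimator_inr (A : Matrix (Fin d) (Fin d) ℂ) (u : UnitVec d) :
    (A * singleEstimator (Sum.inr u)).trace = braket (dualObservable A) u := by
  rw [dualObservable, braket_add, braket_smul, braket_smul, braket_one, singleEstimator, mul_sub,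
    mul_smul_comm, Matrix.trace_sub, Matrix.trace_smul, trace_mul_ketbra, mul_one, smul_eq_mul]
  ring

theorem bddMeas_trace_mul_singleEstimator (A : Matrix (Fin d) (Fin d) ℂ) :
    BddMeas fun x : Outcome d => (A * singleEstimator x).trace :=
  ((MatBddMeas.const A).mul matBddMeas_singleEstimator).trace

variable [NeZero d]

/-- The shift in `dualObservable` preserves the trace of `A`, and its contribution -tr(A) tr(σ)
cancels the product of traces in the second Haar moment. -/
theorem integral_trace_mul_singleEstimator (hρ : IsDensityMatrix ρ) (hQ : IsStarProjection Q)
    (A : Matrix (Fin d) (Fin d) ℂ) :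
    ∫ x, (A * singleEstimator x).trace ∂(conditionedPOVM Q ρ) = (A * subState Q ρ).trace := by
  rw [integral_conditionedPOVM hρ hQ (bddMeas_trace_mul_singleEstimator A)
    (by simp [singleEstimator])]
  simp only [trace_mul_singleEstimator_inr, mul_assoc]
  rw [integral_const_mul, integral_braket_mul_braket, Matrix.trace_mul_comm A]
  simp only [dualObservable, mul_add, Matrix.trace_add, Matrix.trace_smul, mul_smul_comm, mul_one,
    Matrix.trace_one, Fintype.card_fin, smul_eq_mul]
  have hd : (d : ℂ) ≠ 0 := Nat.cast_ne_zero.2 (NeZero.ne d)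
  have hd1 : (d : ℂ) + 1 ≠ 0 := by exact_mod_cast Nat.succ_ne_zero d
  field_simp
  ring

theorem integral_trace_mul_trace_singleEstimator (hρ : IsDensityMatrix ρ)
    (hQ : IsStarProjection Q) (A B : Matrix (Fin d) (Fin d) ℂ) :
    ((d : ℂ) + 2) * ∫ x, (A * singleEstimator x).trace * (B * singleEstimator x).trace
        ∂(conditionedPOVM Q ρ) =
      -((subState Q ρ).trace * A.trace * B.trace + (subState Q ρ * A).trace * B.trace +
          A.trace * (subState Q ρ * B).trace) +
        (d + 1) * ((subState Q ρ).trace * (A * B).trace + (subState Q ρ * A * B).trace +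
          (subState Q ρ * B * A).trace) := by
  rw [integral_conditionedPOVM hρ hQ ((bddMeas_trace_mul_singleEstimator A).mul
    (bddMeas_trace_mul_singleEstimator B)) (by simp [singleEstimator])]
  simp only [trace_mul_singleEstimator_inr, mul_assoc (d : ℂ)]
  rw [integral_const_mul]
  simp only [← mul_assoc (braket _ _)]
  rw [integral_braket_mul_braket_mul_braket]
  simp only [dualObservable, mul_add, add_mul, Matrix.trace_add, Matrix.trace_smul, mul_smul_comm,
    smul_mul_assoc, mul_one, one_mul, Matrix.trace_one, Fintype.card_fin, smul_eq_mul]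
  have hd : (d : ℂ) ≠ 0 := Nat.cast_ne_zero.2 (NeZero.ne d)
  have hd1 : (d : ℂ) + 1 ≠ 0 := by exact_mod_cast Nat.succ_ne_zero d
  have hd2 : (d : ℂ) + 2 ≠ 0 := by exact_mod_cast Nat.succ_ne_zero (d + 1)
  field_simp
  ring

omit [NeZero d] in
-- The quartic part collapses because |u⟩⟨u|D|u⟩⟨u| = ⟨u|D|u⟩ |u⟩⟨u|, so three Haar moments suffice
-- even after weighting by the state.
theorem trace_sandwich_singleEstimator_inr (Z D : Matrix (Fin d) (Fin d) ℂ) (u : UnitVec d) :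
    (Z * singleEstimator (Sum.inr u) * D * singleEstimator (Sum.inr u)).trace =
      ((d : ℂ) + 1) ^ 2 * (braket Z u * braket D u) +
        braket ((-((d : ℂ) + 1)) • (D * Z + Z * D) + (Z * D).trace • 1) u := by
  have h1 : (Z * ketbra u * D * ketbra u).trace = braket Z u * braket D u := by
    rw [mul_assoc, mul_assoc, ← mul_assoc (ketbra u), ketbra_mul_mul_ketbra, mul_smul_comm,
      Matrix.trace_smul, trace_mul_ketbra, smul_eq_mul, mul_comm]
  have h2 : (Z * ketbra u * D).trace = braket (D * Z) u := by
    rw [Matrix.trace_mul_comm, ← mul_assoc, trace_mul_ketbra]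
  simp only [singleEstimator, braket_add, braket_smul, braket_one, mul_sub, sub_mul, mul_one,
    mul_smul_comm, smul_mul_assoc, Matrix.trace_sub, Matrix.trace_smul, h1, h2, trace_mul_ketbra,
    smul_eq_mul]
  ring

theorem integral_trace_sandwich_singleEstimator (hρ : IsDensityMatrix ρ)
    (hQ : IsStarProjection Q) (Z D : Matrix (Fin d) (Fin d) ℂ) :
    ((d : ℂ) + 2) * ∫ x, (Z * singleEstimator x * D * singleEstimator x).trace
        ∂(conditionedPOVM Q ρ) =
      -((subState Q ρ).trace * (Z * D).trace + (subState Q ρ * Z * D).trace +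
          (subState Q ρ * D * Z).trace) +
        (d + 1) * ((subState Q ρ).trace * Z.trace * D.trace + (subState Q ρ * Z).trace * D.trace +
          Z.trace * (subState Q ρ * D).trace) := by
  rw [integral_conditionedPOVM hρ hQ ((((MatBddMeas.const Z).mul matBddMeas_singleEstimator).mul
    (MatBddMeas.const D)).mul matBddMeas_singleEstimator).trace (by simp [singleEstimator])]
  simp only [trace_sandwich_singleEstimator_inr]
  set G : Matrix (Fin d) (Fin d) ℂ :=
    (-((d : ℂ) + 1)) • (D * Z + Z * D) + (Z * D).trace • 1 with hG
  have e : ∀ u : UnitVec d, (d : ℂ) * braket (subState Q ρ) u *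
      (((d : ℂ) + 1) ^ 2 * (braket Z u * braket D u) + braket G u) =
      (d * ((d : ℂ) + 1) ^ 2) * (braket (subState Q ρ) u * braket Z u * braket D u) +
        d * (braket (subState Q ρ) u * braket G u) := fun u => by ring
  simp only [e]
  rw [BddMeas.integral_add (E := ℂ)
    (BddMeas.mul (E := ℂ) (.const _)
      (((bddMeas_braket _).mul (bddMeas_braket _)).mul (bddMeas_braket _)))
    (BddMeas.mul (E := ℂ) (.const _) ((bddMeas_braket _).mul (bddMeas_braket _))),
    integral_const_mul, integral_const_mul, integral_braket_mul_braket_mul_braket,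
    integral_braket_mul_braket, hG]
  simp only [mul_add, Matrix.trace_add, Matrix.trace_smul, mul_smul_comm, mul_one,
    Matrix.trace_one, Fintype.card_fin, smul_eq_mul, Matrix.trace_mul_comm D Z, ← mul_assoc]
  have hd : (d : ℂ) ≠ 0 := Nat.cast_ne_zero.2 (NeZero.ne d)
  have hd1 : (d : ℂ) + 1 ≠ 0 := by exact_mod_cast Nat.succ_ne_zero d
  have hd2 : (d : ℂ) + 2 ≠ 0 := by exact_mod_cast Nat.succ_ne_zero (d + 1)
  field_simp
  ring

/-- In both exact formulas the terms with coefficient `d + 1` are three quantities, each at most the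
target since 0 ≤ σ ≤ 1 and tr σ ≤ 1. This is the origin of the 3; the terms with a minus sign must
be shown to do no harm. -/
theorem isEstimator_singleEstimator (hρ : IsDensityMatrix ρ) (hQ : IsStarProjection Q) :
    IsEstimator (conditionedPOVM Q ρ) (singleEstimator (d := d)) (subState Q ρ) := by
  have := isProbabilityMeasure_conditionedPOVM hρ hQ
  set σ := subState Q ρ with hσdef
  have hσ : σ.PosSemidef := posSemidef_subState hρ hQ
  have htr : σ.trace.re ≤ 1 := by
    have h1 := re_trace_mul_add_re_trace_subState hρ hQ
    have h2 := re_trace_mul_nonneg hρ hQ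
    linarith
  have htr0 : 0 ≤ σ.trace.re := (Complex.le_def.1 hσ.trace_nonneg).1
  have hone := one_sub_posSemidef_of_trace_le_one hσ htr
  have hsim : σ.trace.im = 0 := (Complex.le_def.1 hσ.trace_nonneg).2.symm
  have hd : (0 : ℝ) < d := Nat.cast_pos.2 (NeZero.pos d)
  have hre : ∀ z : ℂ, (((d : ℂ) + 2) * z).re = (d + 2) * z.re := fun z => by
    have : (d : ℂ) + 2 = ((d + 2 : ℝ) : ℂ) := by push_cast; rfl
    rw [this, Complex.re_ofReal_mul]
  have hre' : ∀ z : ℂ, (((d : ℂ) + 1) * z).re = (d + 1) * z.re := fun z => by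
    have : (d : ℂ) + 1 = ((d + 1 : ℝ) : ℂ) := by push_cast; rfl
    rw [this, Complex.re_ofReal_mul]
  refine ⟨matBddMeas_singleEstimator, isHermitian_singleEstimator, fun p q => ?_, fun B => ?_,
    fun a V => ?_⟩
  · have h := integral_trace_mul_singleEstimator hρ hQ (Matrix.single q p 1)
    simpa [Matrix.trace_single_mul] using h
  · have hX : ∀ x : Outcome d, ‖(singleEstimator x * B).trace‖ ^ 2 =
        ((B.conjTranspose * singleEstimator x).trace * (B * singleEstimator x).trace).re :=
      fun x => by
        have h1 : (B.conjTranspose * singleEstimator x).trace =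
            star (singleEstimator x * B).trace := by
          rw [← Matrix.trace_conjTranspose, Matrix.conjTranspose_mul,
            (isHermitian_singleEstimator x).eq]
        rw [h1, Matrix.trace_mul_comm B, Complex.star_def, mul_comm, Complex.mul_conj,
          Complex.ofReal_re, Complex.normSq_eq_norm_sq]
    simp only [hX]
    have hB := (bddMeas_trace_mul_singleEstimator B.conjTranspose).mul
      (bddMeas_trace_mul_singleEstimator B)
    have hint : ∫ x, ((B.conjTranspose * singleEstimator x).trace *
          (B * singleEstimator x).trace).re ∂(conditionedPOVM Q ρ) =
        (∫ x, (B.conjTranspose * singleEstimator x).trace * (B * singleEstimator x).trace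
          ∂(conditionedPOVM Q ρ)).re := integral_re (𝕜 := ℂ) (hB.integrable _)
    rw [hint]
    have h := congrArg Complex.re
      (integral_trace_mul_trace_singleEstimator hρ hQ B.conjTranspose B)
    rw [hre, Complex.add_re, hre', Complex.neg_re, ← hσdef] at h
    set I : ℝ := (∫ x, (B.conjTranspose * singleEstimator x).trace * (B * singleEstimator x).trace
          ∂(conditionedPOVM Q ρ)).re
    have hF : (B.conjTranspose * B).trace.re = frobSq B := rfl
    have hL : (σ * B.conjTranspose * B).trace.re ≤ frobSq B := by
      rw [mul_assoc]
      exact re_trace_mul_le hone (Matrix.posSemidef_conjTranspose_mul_self B)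
    have hR : (σ * B * B.conjTranspose).trace.re ≤ frobSq B := by
      rw [mul_assoc, ← hF, Matrix.trace_mul_comm B.conjTranspose]
      exact re_trace_mul_le hone (Matrix.posSemidef_self_mul_conjTranspose B)
    have hs : (σ.trace * (B.conjTranspose * B).trace).re ≤ frobSq B := by
      rw [trace_conjTranspose_mul_self, Complex.re_mul_ofReal]
      exact mul_le_of_le_one_left (frobSq_nonneg B) htr
    -- The subtracted terms have no sign by themselves. Adding tr(σBB*) completes them to tr((B + tr
    -- B)* σ (B + tr B)) ≥ 0, and this extra term fits into the slack between 3(d + 1) and 3(d + 2).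
    have hcross : 0 ≤ (σ.trace * B.conjTranspose.trace * B.trace +
        (σ * B.conjTranspose).trace * B.trace + B.conjTranspose.trace * (σ * B).trace +
        (σ * B * B.conjTranspose).trace).re := by
      have h1 := (Complex.le_def.1 (hσ.conjTranspose_mul_mul_same
        (B + B.trace • 1)).trace_nonneg).1
      rw [Complex.zero_re] at h1
      refine h1.trans_eq (congrArg Complex.re ?_)
      have e1 : (B.conjTranspose * σ).trace = (σ * B.conjTranspose).trace :=
        Matrix.trace_mul_comm _ _
      have e2 : (B.conjTranspose * σ * B).trace = (σ * B * B.conjTranspose).trace := by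
        rw [mul_assoc, Matrix.trace_mul_comm]
      simp only [Matrix.conjTranspose_add, Matrix.conjTranspose_smul, Matrix.conjTranspose_one,
        add_mul, mul_add, smul_mul_assoc, mul_smul_comm, one_mul, mul_one, Matrix.trace_add,
        Matrix.trace_smul, smul_eq_mul, Matrix.trace_conjTranspose, e1, e2]
      ring
    simp only [Complex.add_re] at h hcross
    have hF0 := frobSq_nonneg B
    have h3 : (d + 2) * I ≤ (d + 2) * (3 * frobSq B) := by
      have h4 := mul_le_mul_of_nonneg_left (add_le_add (add_le_add hs hL) hR)
        (by positivity : (0 : ℝ) ≤ d + 1)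
      rw [h]
      linarith
    exact le_of_mul_le_mul_left h3 (by positivity)
  · set Z := σ ^ (2 * a) with hZdef
    set D := V * V.conjTranspose with hDdef
    have hZ : Z.PosSemidef := hσ.pow _
    have hD : D.PosSemidef := Matrix.posSemidef_self_mul_conjTranspose V
    have hσZ : (σ * Z).PosSemidef := by
      rw [hZdef, ← pow_succ']
      exact hσ.pow _
    have hX : ∀ x : Outcome d, frobSq (σ ^ a * (singleEstimator x * V)) =
        (Z * singleEstimator x * D * singleEstimator x).trace.re := fun x => by
      rw [frobSq, Matrix.conjTranspose_mul, Matrix.conjTranspose_mul, Matrix.conjTranspose_pow,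
        hσ.1.eq, (isHermitian_singleEstimator x).eq]
      have e : V.conjTranspose * singleEstimator x * σ ^ a * (σ ^ a * (singleEstimator x * V)) =
          V.conjTranspose * (singleEstimator x * (Z * singleEstimator x * V)) := by
        rw [hZdef, two_mul, pow_add]
        simp only [mul_assoc]
      rw [e, Matrix.trace_mul_comm, mul_assoc, Matrix.trace_mul_comm, hDdef]
      simp only [mul_assoc]
    simp only [hX]
    have hB : BddMeas fun x : Outcome d => (Z * singleEstimator x * D * singleEstimator x).trace :=
      ((((MatBddMeas.const Z).mul matBddMeas_singleEstimator).mul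
        (MatBddMeas.const D)).mul matBddMeas_singleEstimator).trace
    have hint : ∫ x, (Z * singleEstimator x * D * singleEstimator x).trace.re
          ∂(conditionedPOVM Q ρ) =
        (∫ x, (Z * singleEstimator x * D * singleEstimator x).trace
          ∂(conditionedPOVM Q ρ)).re := integral_re (𝕜 := ℂ) (hB.integrable _)
    rw [hint]
    have h := congrArg Complex.re (integral_trace_sandwich_singleEstimator hρ hQ Z D)
    rw [hre, Complex.add_re, hre', Complex.neg_re, ← hσdef] at h
    set I : ℝ := (∫ x, (Z * singleEstimator x * D * singleEstimator x).trace
          ∂(conditionedPOVM Q ρ)).re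
    have hF : D.trace.re = frobSq V := by
      rw [hDdef, Matrix.trace_mul_comm]
      rfl
    obtain ⟨z0, zi⟩ := Complex.le_def.1 hZ.trace_nonneg
    obtain ⟨d0, di⟩ := Complex.le_def.1 hD.trace_nonneg
    obtain ⟨zd0, zdi⟩ := Complex.le_def.1 (trace_mul_posSemidef_nonneg hZ hD)
    obtain ⟨sz0, szi⟩ := Complex.le_def.1 hσZ.trace_nonneg
    obtain ⟨sd0, sdi⟩ := Complex.le_def.1 (trace_mul_posSemidef_nonneg hσ hD)
    have szd0 := (Complex.le_def.1 (trace_mul_posSemidef_nonneg hσZ hD)).1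
    -- Since `Z` is a power of σ, both triple traces equal tr(σZ·D), a product of positive
    -- semidefinite matrices, so all the subtracted terms are nonnegative.
    have hcomm : (σ * D * Z).trace = (σ * Z * D).trace := by
      rw [Matrix.trace_mul_comm, ← mul_assoc]
      congr 2
      rw [hZdef, ← pow_succ, ← pow_succ']
    have hsz := re_trace_mul_le hone hZ
    have hsd := re_trace_mul_le hone hD
    simp only [Complex.zero_re, Complex.zero_im] at z0 zi d0 di zd0 zdi sz0 szi sd0 sdi szd0
    simp only [hcomm, Complex.add_re, Complex.mul_re, Complex.mul_im, ← zi, ← di, ← zdi, ← szi,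
      ← sdi, hsim, mul_zero, zero_mul, sub_zero, add_zero] at h
    rw [← hF]
    have k1 : σ.trace.re * Z.trace.re * D.trace.re ≤ Z.trace.re * D.trace.re := by
      rw [mul_assoc]
      exact mul_le_of_le_one_left (mul_nonneg z0 d0) htr
    have k2 : (σ * Z).trace.re * D.trace.re ≤ Z.trace.re * D.trace.re :=
      mul_le_mul_of_nonneg_right hsz d0
    have k3 : Z.trace.re * (σ * D).trace.re ≤ Z.trace.re * D.trace.re :=
      mul_le_mul_of_nonneg_left hsd z0
    have k0 : 0 ≤ σ.trace.re * (Z * D).trace.re := mul_nonneg htr0 zd0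
    have kz : 0 ≤ Z.trace.re * D.trace.re := mul_nonneg z0 d0
    have h3 : (d + 2) * I ≤ (d + 2) * (3 * Z.trace.re * D.trace.re) := by
      have h4 := mul_le_mul_of_nonneg_left (add_le_add (add_le_add k1 k2) k3)
        (by positivity : (0 : ℝ) ≤ d + 1)
      rw [h]
      linarith
    exact le_of_mul_le_mul_left h3 (by positivity)

end SingleCopy

end CondMoment

/-! ### The main theorem -/

theorem proposition5p7 {d : ℕ} (ρ Q : Matrix (Fin d) (Fin d) ℂ)
    (hρ : CondMoment.IsDensityMatrix ρ) (hQ : IsStarProjection Q)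
    (n k : ℕ) (hk : 1 ≤ k) (hkn : (k : ℝ) ≤ (n : ℝ) / 2) :
    (∀ x : Fin n → CondMoment.Outcome d, (CondMoment.momentEstimator k x).im = 0) ∧
    MemLp (fun x => CondMoment.momentEstimator k x) 2 (CondMoment.outcomeLaw n Q ρ) ∧
    ∫ x, CondMoment.momentEstimator k x ∂(CondMoment.outcomeLaw n Q ρ) =
      (CondMoment.subState Q ρ ^ k).trace ∧
    ProbabilityTheory.variance (fun x => (CondMoment.momentEstimator k x).re)
        (CondMoment.outcomeLaw n Q ρ) ≤
      (24 : ℝ) ^ k / (d : ℝ) *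
        ∑ j ∈ Finset.range k,
          ((k : ℝ) * (d : ℝ) / (n : ℝ)) ^ (k - j) *
            (CondMoment.subState Q ρ ^ (2 * j)).trace.re := by
  -- A matrix of size zero has trace 0, so a density matrix forces `d ≠ 0`.
  have hd : NeZero d := ⟨by
    rintro rfl
    simpa [Matrix.trace] using hρ.trace_eq_one⟩
  have hkn' : k ≤ n := by
    have h0 : (0 : ℝ) ≤ n := Nat.cast_nonneg n
    have h1 : (k : ℝ) ≤ n := by linarith
    exact_mod_cast h1
  have hest := CondMoment.isEstimator_singleEstimator hρ hQ
  have hσ := CondMoment.posSemidef_subState hρ hQ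
  have := CondMoment.isProbabilityMeasure_conditionedPOVM hρ hQ
  -- `momentEstimator` and `outcomeLaw` unfold to `traceUStat` of `singleEstimator` and to a product
  -- measure, so the abstract results apply directly.
  refine ⟨fun x => CondMoment.traceUStat_im CondMoment.isHermitian_singleEstimator x,
    (CondMoment.bddMeas_traceUStat hest.bddMeas).memLp (Measure.pi fun _ => _) 2,
    hest.integral_traceUStat hkn', ?_⟩
  refine (hest.variance_traceUStat_le hσ (by omega) hkn').trans ?_
  refine (CondMoment.sum_choose_mul_covBound_le hσ n k).trans ?_
  rw [Fintype.card_fin]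
  refine mul_le_mul_of_nonneg_right ?_ (Finset.sum_nonneg fun j _ =>
    mul_nonneg (by positivity) (CondMoment.re_trace_pow_nonneg hσ _))
  -- What remains is 6^k ≤ 24^k.
  gcongr
  norm_num
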